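/- An order is a tuple consisting of an id, a timestamp, a quantity and a limit price, all natural numbers, with quantity at least $1$. Let $B$ be a finite list of orders called bids and $A$ a finite list of orders called asks, such that all the ids of the orders in $B$ and $A$ are distinct and all their timestamps are distinct. A transaction $(b,a,q,p)$ consists of a bid $b$, an ask $a$, a quantity $q$ and a price $p$. For a finite collection $M$ of transactions, $\mathrm{Vol}(M)$ is the sum of the quantities of all transactions in $M$, and $\mathrm{Qty}(w,M)$ is the sum of the quantities of those that involve the order $w$. $M$ is a matching over $(B,A)$ if every $(b,a,q,p)\in M$ satisfies $b\in B$, $a\in A$ and $\mathrm{price}(a)\le p\le \mathrm{price}(b)$, and $\mathrm{Qty}(w,M)\le \mathrm{qty}(w)$ for every order $w$ in $B$ or $A$. It is uniform if all its transactions have the same price $p$. A bid $b_1$ is more competitive than a bid $b_2$ if $\mathrm{price}(b_1)>\mathrm{price}(b_2)$, or the prices are equal and $b_1$ has the smaller timestamp; an ask $a_1$ is more competitive than an ask $a_2$ if $\mathrm{price}(a_1)<\mathrm{price}(a_2)$, or the prices are equal and $a_1$ has the smaller timestamp. $M$ is fair if, whenever $w_1$ is more competitive than $w_2$ (both in $B$,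 or both in $A$) and $\mathrm{Qty}(w_2,M)\ge 1$, one has $\mathrm{Qty}(w_1,M)=\mathrm{qty}(w_1)$. In the comparison model an algorithm has no access to the values of the prices: the only operation on prices, besides copying them, is to compare two of them, which takes one unit of time. Each other elementary step (memory access, addition, subtraction or comparison of numbers, allocation of a cell, test, function call) takes one unit of time as well. Theorem. There is an algorithm in the comparison model that, on every input $(B,A)$ as above, halts in time $O(n)$, where $n=|B|+|A|$, and outputs a list, without repetitions, of the transactions of a matching $M$ over $(B,A)$ that is uniform and fair and that has maximum volume: $\mathrm{Vol}(M')\le \mathrm{Vol}(M)$ for every uniform matching $M'$ over $(B,A)$, fair or not. -/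

import Mathlib

open Asymptotics Filter

namespace Exchange

/-! ### Orders, transactions, matchings -/

/-- An order (a bid or an ask, depending on the list in which it is placed). -/
structure Order where
  id : ℕ
  timestamp : ℕ
  qty : ℕ
  price : ℕ
  qty_pos : 1 ≤ qty
deriving DecidableEq

/-- A transaction: `qty` units change hands between `bid` and `ask`, at `price` per unit. -/
structure Transaction where
  bid : Order
  ask : Order
  qty : ℕ
  price : ℕ
deriving DecidableEq

/-- A bid `b` and an ask `a` are tradable. -/
def Tradable (b a : Order) : Prop := a.price ≤ b.price

/-- `Qty(w, M)`: the total quantity of the transactions in `M` that involve the order `w`. -/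
def tradedQty (w : Order) (M : List Transaction) : ℕ :=
  ((M.filter fun m => m.bid = w ∨ m.ask = w).map Transaction.qty).sum

/-- `Vol(M)`: the total quantity of all the transactions in `M`. -/
def volume (M : List Transaction) : ℕ := (M.map Transaction.qty).sum

/-- `M` is a matching over the bids `B` and the asks `A`. The price of a transaction respects the
limit prices of its bid and its ask. -/
structure IsMatching (B A : List Order) (M : List Transaction) : Prop where
  bid_mem : ∀ m ∈ M, m.bid ∈ B
  ask_mem : ∀ m ∈ M, m.ask ∈ A
  tradable : ∀ m ∈ M, Tradable m.bid m.ask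
  ask_price_le : ∀ m ∈ M, m.ask.price ≤ m.price
  price_le_bid : ∀ m ∈ M, m.price ≤ m.bid.price
  qty_le : ∀ w ∈ B ++ A, tradedQty w M ≤ w.qty

/-- All transactions occur at a common price. -/
def IsUniform (M : List Transaction) : Prop := ∃ p : ℕ, ∀ m ∈ M, m.price = p

/-- The bid `b₁` is more competitive than the bid `b₂`. -/
def BidMoreCompetitive (b₁ b₂ : Order) : Prop :=
  b₂.price < b₁.price ∨ (b₁.price = b₂.price ∧ b₁.timestamp < b₂.timestamp)

/-- The ask `a₁` is more competitive than the ask `a₂`. -/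
def AskMoreCompetitive (a₁ a₂ : Order) : Prop :=
  a₁.price < a₂.price ∨ (a₁.price = a₂.price ∧ a₁.timestamp < a₂.timestamp)

/-- `M` is fair on the bids `B`. -/
def FairOnBids (B : List Order) (M : List Transaction) : Prop :=
  ∀ b₁ ∈ B, ∀ b₂ ∈ B, BidMoreCompetitive b₁ b₂ → 1 ≤ tradedQty b₂ M → tradedQty b₁ M = b₁.qty

/-- `M` is fair on the asks `A`. -/
def FairOnAsks (A : List Order) (M : List Transaction) : Prop :=
  ∀ a₁ ∈ A, ∀ a₂ ∈ A, AskMoreCompetitive a₁ a₂ → 1 ≤ tradedQty a₂ M → tradedQty a₁ M = a₁.qty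

/-- `M` is fair. -/
def IsFair (B A : List Order) (M : List Transaction) : Prop := FairOnBids B M ∧ FairOnAsks A M

/-! ### The comparison model

Algorithms are programs of a first-order call-by-value language whose data are natural numbers,
prices, and immutable cons cells. Passing a value around is passing a number or a pointer. A price
is opaque: there are no price constants, no price arithmetic and no conversion between prices and
numbers, and the only operation that depends on prices is the comparison of two of them. Every
evaluated node of an expression (a variable access, an allocation or projection of a cell, an
addition or subtraction, a test, a comparison of two numbers or of two prices, a function call)
takes one unit of time. -/

/-- The data of a computation. -/
inductive Val where
  | nil : Val
  | nat (n : ℕ) : Val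
  | price (p : ℕ) : Val
  | pair (v w : Val) : Val

/-- Expressions. Variables are de Bruijn indices into the current environment. -/
inductive Expr where
  | var (i : ℕ) : Expr
  | nil : Expr
  | num (n : ℕ) : Expr
  | add (e₁ e₂ : Expr) : Expr
  | sub (e₁ e₂ : Expr) : Expr
  | pair (e₁ e₂ : Expr) : Expr
  | fst (e : Expr) : Expr
  | snd (e : Expr) : Expr
  /-- evaluate `e₁`, and then `e₂` with the value of `e₁` as the new variable `0` -/
  | bind (e₁ e₂ : Expr) : Expr
  /-- if `e` is the empty list then `e₁` else (if it is a cons cell) `e₂` -/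
  | ifNil (e e₁ e₂ : Expr) : Expr
  /-- if the number `l` is at most the number `r` then `e₁` else `e₂` -/
  | ifNatLe (l r e₁ e₂ : Expr) : Expr
  /-- the oracle: if the price `l` is at most the price `r` then `e₁` else `e₂` -/
  | ifPriceLe (l r e₁ e₂ : Expr) : Expr
  /-- call the function number `f` of the program with the value of `e` as its argument -/
  | call (f : ℕ) (e : Expr) : Expr

/-- A program: finitely many, possibly mutually recursive, functions of one argument (variable `0`
of the body), and a main expression whose variable `0` is the input. -/
structure Program where
  funs : List Expr
  main : Expr

/-- `Eval F ρ e v t`: with the function bodies `F` and in the environment `ρ`, the evaluation of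
`e` halts with the value `v` after `t` units of time. -/
inductive Eval (F : List Expr) : List Val → Expr → Val → ℕ → Prop where
  | var {ρ i v} : ρ[i]? = some v → Eval F ρ (.var i) v 1
  | nil {ρ} : Eval F ρ .nil .nil 1
  | num {ρ n} : Eval F ρ (.num n) (.nat n) 1
  | add {ρ e₁ e₂ m n s t} : Eval F ρ e₁ (.nat m) s → Eval F ρ e₂ (.nat n) t →
      Eval F ρ (.add e₁ e₂) (.nat (m + n)) (s + t + 1)
  | sub {ρ e₁ e₂ m n s t} : Eval F ρ e₁ (.nat m) s → Eval F ρ e₂ (.nat n) t →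
      Eval F ρ (.sub e₁ e₂) (.nat (m - n)) (s + t + 1)
  | pair {ρ e₁ e₂ v w s t} : Eval F ρ e₁ v s → Eval F ρ e₂ w t →
      Eval F ρ (.pair e₁ e₂) (.pair v w) (s + t + 1)
  | fst {ρ e v w t} : Eval F ρ e (.pair v w) t → Eval F ρ (.fst e) v (t + 1)
  | snd {ρ e v w t} : Eval F ρ e (.pair v w) t → Eval F ρ (.snd e) w (t + 1)
  | bind {ρ e₁ e₂ v w s t} : Eval F ρ e₁ v s → Eval F (v :: ρ) e₂ w t →
      Eval F ρ (.bind e₁ e₂) w (s + t + 1)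
  | ifNil_nil {ρ e e₁ e₂ w s t} : Eval F ρ e .nil s → Eval F ρ e₁ w t →
      Eval F ρ (.ifNil e e₁ e₂) w (s + t + 1)
  | ifNil_pair {ρ e e₁ e₂ v v' w s t} : Eval F ρ e (.pair v v') s → Eval F ρ e₂ w t →
      Eval F ρ (.ifNil e e₁ e₂) w (s + t + 1)
  | ifNatLe_le {ρ l r e₁ e₂ m n w s s' t} : Eval F ρ l (.nat m) s → Eval F ρ r (.nat n) s' →
      m ≤ n → Eval F ρ e₁ w t → Eval F ρ (.ifNatLe l r e₁ e₂) w (s + s' + t + 1)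
  | ifNatLe_gt {ρ l r e₁ e₂ m n w s s' t} : Eval F ρ l (.nat m) s → Eval F ρ r (.nat n) s' →
      n < m → Eval F ρ e₂ w t → Eval F ρ (.ifNatLe l r e₁ e₂) w (s + s' + t + 1)
  | ifPriceLe_le {ρ l r e₁ e₂ p q w s s' t} : Eval F ρ l (.price p) s →
      Eval F ρ r (.price q) s' → p ≤ q → Eval F ρ e₁ w t →
      Eval F ρ (.ifPriceLe l r e₁ e₂) w (s + s' + t + 1)
  | ifPriceLe_gt {ρ l r e₁ e₂ p q w s s' t} : Eval F ρ l (.price p) s →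
      Eval F ρ r (.price q) s' → q < p → Eval F ρ e₂ w t →
      Eval F ρ (.ifPriceLe l r e₁ e₂) w (s + s' + t + 1)
  | call {ρ f e body v w s t} : F[f]? = some body → Eval F ρ e v s → Eval F [v] body w t →
      Eval F ρ (.call f e) w (s + t + 1)

/-- The program `P` halts on the input `v` with the output `w` after `t` units of time. -/
def Program.HaltsWith (P : Program) (v w : Val) (t : ℕ) : Prop := Eval P.funs [v] P.main w t

/-- Evaluation is deterministic: the output and the running time are functions of the input. -/
theorem Eval.unique {F : List Expr} {ρ : List Val} {e : Expr} {v w : Val} {s t : ℕ}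
    (h : Eval F ρ e v s) (h' : Eval F ρ e w t) : v = w ∧ s = t := by
  induction h generalizing w t with
  | var h => cases h'; simp_all
  | nil => cases h'; simp
  | num => cases h'; simp
  | fst _ ih => cases h' with | fst h => have := ih h; simp_all
  | snd _ ih => cases h' with | snd h => have := ih h; simp_all
  | add _ _ ih₁ ih₂ => cases h' with | add h₁ h₂ => have := ih₁ h₁; have := ih₂ h₂; simp_all
  | sub _ _ ih₁ ih₂ => cases h' with | sub h₁ h₂ => have := ih₁ h₁; have := ih₂ h₂; simp_all
  | pair _ _ ih₁ ih₂ => cases h' with | pair h₁ h₂ => have := ih₁ h₁; have := ih₂ h₂; simp_all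
  | bind _ _ ih₁ ih₂ =>
    cases h' with
    | bind h₁ h₂ => obtain ⟨rfl, rfl⟩ := ih₁ h₁; have := ih₂ h₂; simp_all
  | ifNil_nil _ _ ih₁ ih₂ =>
    cases h' with
    | ifNil_nil h₁ h₂ => have := ih₁ h₁; have := ih₂ h₂; simp_all
    | ifNil_pair h₁ h₂ => have := ih₁ h₁; simp_all
  | ifNil_pair _ _ ih₁ ih₂ =>
    cases h' with
    | ifNil_nil h₁ h₂ => have := ih₁ h₁; simp_all
    | ifNil_pair h₁ h₂ => have := ih₁ h₁; have := ih₂ h₂; simp_all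
  | ifNatLe_le _ _ hle _ ih₁ ih₂ ih₃ =>
    cases h' with
    | ifNatLe_le h₁ h₂ _ h₃ => have := ih₁ h₁; have := ih₂ h₂; have := ih₃ h₃; simp_all
    | ifNatLe_gt h₁ h₂ hlt _ => have := ih₁ h₁; have := ih₂ h₂; simp_all; omega
  | ifNatLe_gt _ _ hlt _ ih₁ ih₂ ih₃ =>
    cases h' with
    | ifNatLe_le h₁ h₂ hle _ => have := ih₁ h₁; have := ih₂ h₂; simp_all; omega
    | ifNatLe_gt h₁ h₂ _ h₃ => have := ih₁ h₁; have := ih₂ h₂; have := ih₃ h₃; simp_all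
  | ifPriceLe_le _ _ hle _ ih₁ ih₂ ih₃ =>
    cases h' with
    | ifPriceLe_le h₁ h₂ _ h₃ => have := ih₁ h₁; have := ih₂ h₂; have := ih₃ h₃; simp_all
    | ifPriceLe_gt h₁ h₂ hlt _ => have := ih₁ h₁; have := ih₂ h₂; simp_all; omega
  | ifPriceLe_gt _ _ hlt _ ih₁ ih₂ ih₃ =>
    cases h' with
    | ifPriceLe_le h₁ h₂ hle _ => have := ih₁ h₁; have := ih₂ h₂; simp_all; omega
    | ifPriceLe_gt h₁ h₂ _ h₃ => have := ih₁ h₁; have := ih₂ h₂; have := ih₃ h₃; simp_all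
  | call hf _ _ ih₁ ih₂ =>
    cases h' with
    | call hf' h₁ h₂ =>
      obtain ⟨rfl, rfl⟩ := ih₁ h₁
      obtain rfl := Option.some.inj (hf.symm.trans hf')
      have := ih₂ h₂
      simp_all

/-! ### Input and output -/

/-- A list as a chain of cons cells. -/
def encodeList {α : Type} (enc : α → Val) : List α → Val
  | [] => .nil
  | x :: l => .pair (enc x) (encodeList enc l)

/-- The tuple (id, timestamp, quantity, price), with an opaque price. -/
def encodeOrder (w : Order) : Val :=
  .pair (.nat w.id) (.pair (.nat w.timestamp) (.pair (.nat w.qty) (.price w.price)))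

/-- The tuple (id of the bid, id of the ask, quantity, price), with an opaque price. -/
def encodeTransaction (m : Transaction) : Val :=
  .pair (.nat m.bid.id) (.pair (.nat m.ask.id) (.pair (.nat m.qty) (.price m.price)))

/-- The input that consists of the list of bids `B` and the list of asks `A`. -/
def encodeInput (B A : List Order) : Val :=
  .pair (encodeList encodeOrder B) (encodeList encodeOrder A)

/-- The output that lists the transactions in `M`. -/
def encodeOutput (M : List Transaction) : Val := encodeList encodeTransaction M

end Exchange

namespace Exchange

/-! ### Evaluation within a time bound -/

/-! Put all orders into one book by increasing price, asks before bids at equal prices, and ties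
within a side broken so that the more competitive ask comes earlier and the more competitive bid
later (`rank`). Let D be the total quantity of the bids and cut the book after its lowest D units.
If s of the units below the cut belong to asks, then D - s belong to bids, so exactly s units of
bids lie above the cut. Thus the asks below and the bids above balance, and they can be paired
greedily (`pairUp`) at the price of the order `x` where the cut falls, a price that is merely
copied. `IsAllocation` records what is needed of the two lists.

Fairness holds because, on each side, every order more competitive than a traded one lies strictly
beyond `x` and is traded in full. For optimality, consider a uniform matching with price q. If all
asks priced at most q come strictly before `x`, then the asks before `x` meet every transaction.
Otherwise some such ask is at or after `x`; as asks precede bids of the same price, every bid priced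
at least q is strictly after `x`, and the bids after `x` meet every transaction. Either set of
orders has total quantity at most s, which bounds the volume (`volume_le_weight`,
`IsAllocation.volume_le`).

The cut is found without sorting, by weighted selection (`runs_select`). The pivot is a median of
medians of medians of three: one recursive call on about n/9 items finds it, and a second treats at
most about 7n/9 items. These fractions sum to less than 1, so selection is linear; the rest is a
constant number of linear passes. -/

/-- The evaluation of `e` halts with the value `v` after at most `T` units of time. -/
def Runs (F : List Expr) (ρ : List Val) (e : Expr) (v : Val) (T : ℕ) : Prop :=
  ∃ t ≤ T, Eval F ρ e v t

namespace Runs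

variable {F : List Expr} {ρ : List Val} {e e₁ e₂ l r : Expr} {v w : Val} {m n s s' t t' T i f : ℕ}

theorem mono (h : Runs F ρ e v t) (hT : t ≤ T) : Runs F ρ e v T := by
  obtain ⟨u, hu, h⟩ := h
  exact ⟨u, hu.trans hT, h⟩

theorem var (h : ρ[i]? = some v) : Runs F ρ (.var i) v 1 := ⟨1, le_rfl, .var h⟩

theorem nil : Runs F ρ .nil .nil 1 := ⟨1, le_rfl, .nil⟩

theorem num : Runs F ρ (.num n) (.nat n) 1 := ⟨1, le_rfl, .num⟩

theorem add (h₁ : Runs F ρ e₁ (.nat m) s) (h₂ : Runs F ρ e₂ (.nat n) t) :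
    Runs F ρ (.add e₁ e₂) (.nat (m + n)) (s + t + 1) := by
  obtain ⟨u₁, hu₁, h₁⟩ := h₁
  obtain ⟨u₂, hu₂, h₂⟩ := h₂
  exact ⟨_, by omega, .add h₁ h₂⟩

theorem sub (h₁ : Runs F ρ e₁ (.nat m) s) (h₂ : Runs F ρ e₂ (.nat n) t) :
    Runs F ρ (.sub e₁ e₂) (.nat (m - n)) (s + t + 1) := by
  obtain ⟨u₁, hu₁, h₁⟩ := h₁
  obtain ⟨u₂, hu₂, h₂⟩ := h₂
  exact ⟨_, by omega, .sub h₁ h₂⟩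

theorem pair (h₁ : Runs F ρ e₁ v s) (h₂ : Runs F ρ e₂ w t) :
    Runs F ρ (.pair e₁ e₂) (.pair v w) (s + t + 1) := by
  obtain ⟨u₁, hu₁, h₁⟩ := h₁
  obtain ⟨u₂, hu₂, h₂⟩ := h₂
  exact ⟨_, by omega, .pair h₁ h₂⟩

theorem fst (h : Runs F ρ e (.pair v w) t) : Runs F ρ (.fst e) v (t + 1) := by
  obtain ⟨u, hu, h⟩ := h
  exact ⟨_, by omega, .fst h⟩

theorem snd (h : Runs F ρ e (.pair v w) t) : Runs F ρ (.snd e) w (t + 1) := by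
  obtain ⟨u, hu, h⟩ := h
  exact ⟨_, by omega, .snd h⟩

theorem bind (h₁ : Runs F ρ e₁ v s) (h₂ : Runs F (v :: ρ) e₂ w t) :
    Runs F ρ (.bind e₁ e₂) w (s + t + 1) := by
  obtain ⟨u₁, hu₁, h₁⟩ := h₁
  obtain ⟨u₂, hu₂, h₂⟩ := h₂
  exact ⟨_, by omega, .bind h₁ h₂⟩

theorem ifNil_nil (h₁ : Runs F ρ e .nil s) (h₂ : Runs F ρ e₁ w t) :
    Runs F ρ (.ifNil e e₁ e₂) w (s + t + 1) := by
  obtain ⟨u₁, hu₁, h₁⟩ := h₁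
  obtain ⟨u₂, hu₂, h₂⟩ := h₂
  exact ⟨_, by omega, .ifNil_nil h₁ h₂⟩

theorem ifNil_pair {v' : Val} (h₁ : Runs F ρ e (.pair v v') s) (h₂ : Runs F ρ e₂ w t) :
    Runs F ρ (.ifNil e e₁ e₂) w (s + t + 1) := by
  obtain ⟨u₁, hu₁, h₁⟩ := h₁
  obtain ⟨u₂, hu₂, h₂⟩ := h₂
  exact ⟨_, by omega, .ifNil_pair h₁ h₂⟩

/-- Each branch is analysed under the outcome of the test that leads to it, and the bound takes the
slower one. A branch that cannot occur may be given any bound. -/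
theorem ifNatLe (hl : Runs F ρ l (.nat m) s) (hr : Runs F ρ r (.nat n) s')
    (h₁ : m ≤ n → Runs F ρ e₁ w t) (h₂ : n < m → Runs F ρ e₂ w t') :
    Runs F ρ (.ifNatLe l r e₁ e₂) w (s + s' + max t t' + 1) := by
  obtain ⟨u, hu, hl⟩ := hl
  obtain ⟨u', hu', hr⟩ := hr
  rcases le_or_gt m n with h | h
  · obtain ⟨u₁, hu₁, h₁⟩ := h₁ h
    exact ⟨_, by omega, .ifNatLe_le hl hr h h₁⟩
  · obtain ⟨u₂, hu₂, h₂⟩ := h₂ h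
    exact ⟨_, by omega, .ifNatLe_gt hl hr h h₂⟩

theorem ifPriceLe (hl : Runs F ρ l (.price m) s) (hr : Runs F ρ r (.price n) s')
    (h₁ : m ≤ n → Runs F ρ e₁ w t) (h₂ : n < m → Runs F ρ e₂ w t') :
    Runs F ρ (.ifPriceLe l r e₁ e₂) w (s + s' + max t t' + 1) := by
  obtain ⟨u, hu, hl⟩ := hl
  obtain ⟨u', hu', hr⟩ := hr
  rcases le_or_gt m n with h | h
  · obtain ⟨u₁, hu₁, h₁⟩ := h₁ h
    exact ⟨_, by omega, .ifPriceLe_le hl hr h h₁⟩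
  · obtain ⟨u₂, hu₂, h₂⟩ := h₂ h
    exact ⟨_, by omega, .ifPriceLe_gt hl hr h h₂⟩

theorem call {body : Expr} (hf : F[f]? = some body) (h₁ : Runs F ρ e v s)
    (h₂ : Runs F [v] body w t) : Runs F ρ (.call f e) w (s + t + 1) := by
  obtain ⟨u₁, hu₁, h₁⟩ := h₁
  obtain ⟨u₂, hu₂, h₂⟩ := h₂
  exact ⟨_, by omega, .call hf h₁ h₂⟩

end Runs

/-! ### The order book -/

/-- An order with its side: `0` for an ask, `1` for a bid. -/
abbrev Key : Type := ℕ × Order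

/-- A key with a weight. -/
abbrev Item : Type := ℕ × Key

/-- The position of a key in the order book: by price, asks before bids, earlier asks before
later asks, and later bids before earlier bids. -/
def rank (k : Key) : ℕ ×ₗ ℕ ×ₗ ℤ :=
  toLex (k.2.price, toLex (k.1, if k.1 = 0 then (k.2.timestamp : ℤ) else -k.2.timestamp))

/-- Unfolds the lexicographic order into linear arithmetic on prices, sides and timestamps, so that
`omega` can settle every later comparison of ranks. -/
theorem rank_le_rank {x y : Key} : rank x ≤ rank y ↔
    x.2.price < y.2.price ∨ x.2.price = y.2.price ∧ (x.1 < y.1 ∨ x.1 = y.1 ∧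
      ((x.1 = 0 ∧ x.2.timestamp ≤ y.2.timestamp) ∨ x.1 ≠ 0 ∧ y.2.timestamp ≤ x.2.timestamp)) := by
  simp only [rank, Prod.Lex.toLex_le_toLex]
  constructor
  · rintro (h | ⟨h, h' | ⟨h', h''⟩⟩)
    · exact .inl h
    · exact .inr ⟨h, .inl h'⟩
    · refine .inr ⟨h, .inr ⟨h', ?_⟩⟩
      rw [← h'] at h''
      split_ifs at h'' with h0
      · exact .inl ⟨h0, by omega⟩
      · exact .inr ⟨h0, by omega⟩
  · rintro (h | ⟨h, h' | ⟨h', ⟨h0, h''⟩ | ⟨h0, h''⟩⟩⟩)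
    · exact .inl h
    · exact .inr ⟨h, .inl h'⟩
    · refine .inr ⟨h, .inr ⟨h', ?_⟩⟩
      rw [← h', if_pos h0, if_pos h0]
      omega
    · refine .inr ⟨h, .inr ⟨h', ?_⟩⟩
      rw [← h', if_neg h0, if_neg h0]
      omega

/-- The orders in `L` on the side `s`, weighted by their quantities. -/
def items (s : ℕ) (L : List Order) : List Item := L.map fun o => (o.qty, s, o)

/-- The total weight. -/
def weight (L : List Item) : ℕ := (L.map Prod.fst).sum

/-- The items before `x`. -/
def below (x : Key) (L : List Item) : List Item := L.filter fun y => rank y.2 < rank x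

/-- The items after `x`. -/
def above (x : Key) (L : List Item) : List Item := L.filter fun y => rank x < rank y.2

/-- The median of three keys. -/
def median (x y z : Key) : Key :=
  if rank x ≤ rank y then if rank y ≤ rank z then y else if rank x ≤ rank z then z else x
  else if rank x ≤ rank z then x else if rank y ≤ rank z then z else y

/-- The medians of consecutive triples, each of weight `2`. -/
def medians : List Item → List Item
  | x :: y :: z :: L => (2, median x.2 y.2 z.2) :: medians L
  | _ => []

/-- Match the bids `Bs` with the asks `As`, in the given order, at the price `p`. -/
def pairUp (p : ℕ) : List Item → List Item → List Transaction
  | b :: Bs, a :: As =>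
    if b.1 ≤ a.1 then ⟨b.2.2, a.2.2, b.1, p⟩ :: pairUp p Bs ((a.1 - b.1, a.2) :: As)
    else ⟨b.2.2, a.2.2, a.1, p⟩ :: pairUp p ((b.1 - a.1, b.2) :: Bs) As
  | [], _ => []
  | _ :: _, [] => []
termination_by Bs As => Bs.length + As.length

/-! ### The program -/

/-- The representation of a key. -/
def encodeKey (k : Key) : Val := .pair (.nat k.1) (encodeOrder k.2)

/-- The representation of an item. -/
def encodeItem (x : Item) : Val := .pair (.nat x.1) (encodeKey x.2)

/-- The representation of a list of items. -/
def encodeItems (L : List Item) : Val := encodeList encodeItem L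

/-- The side of a key. -/
def keySide (e : Expr) : Expr := .fst e

/-- The id of a key. -/
def keyId (e : Expr) : Expr := .fst (.snd e)

/-- The timestamp of a key. -/
def keyTime (e : Expr) : Expr := .fst (.snd (.snd e))

/-- The quantity of a key. -/
def keyQty (e : Expr) : Expr := .fst (.snd (.snd (.snd e)))

/-- The price of a key. -/
def keyPrice (e : Expr) : Expr := .snd (.snd (.snd (.snd e)))

section
variable {F : List Expr} {ρ : List Val} {e : Expr} {k : Key} {t : ℕ}

theorem runs_keySide (h : Runs F ρ e (encodeKey k) t) : Runs F ρ (keySide e) (.nat k.1) (t + 1) :=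
  h.fst

theorem runs_keyId (h : Runs F ρ e (encodeKey k) t) :
    Runs F ρ (keyId e) (.nat k.2.id) (t + 2) := h.snd.fst

theorem runs_keyTime (h : Runs F ρ e (encodeKey k) t) :
    Runs F ρ (keyTime e) (.nat k.2.timestamp) (t + 3) := h.snd.snd.fst

theorem runs_keyQty (h : Runs F ρ e (encodeKey k) t) :
    Runs F ρ (keyQty e) (.nat k.2.qty) (t + 4) := h.snd.snd.snd.fst

theorem runs_keyPrice (h : Runs F ρ e (encodeKey k) t) :
    Runs F ρ (keyPrice e) (.price k.2.price) (t + 4) := h.snd.snd.snd.snd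

end

open Exchange.Expr in
/-- Compare two keys: the empty list if `rank x ≤ rank y`. -/
def leBody : Expr :=
  bind (fst (var 0)) <| bind (snd (var 1)) <|
  ifPriceLe (keyPrice (var 1)) (keyPrice (var 0))
    (ifPriceLe (keyPrice (var 0)) (keyPrice (var 1))
      (ifNatLe (keySide (var 1)) (keySide (var 0))
        (ifNatLe (keySide (var 0)) (keySide (var 1))
          (ifNatLe (keySide (var 1)) (num 0)
            (ifNatLe (keyTime (var 1)) (keyTime (var 0)) nil (pair nil nil))
            (ifNatLe (keyTime (var 0)) (keyTime (var 1)) nil (pair nil nil)))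
          nil)
        (pair nil nil))
      nil)
    (pair nil nil)

/-- If the key `x` is at most the key `y` then `e₁` else `e₂`. -/
def ifKeyLe (x y e₁ e₂ : Expr) : Expr := .ifNil (.call 0 (.pair x y)) e₁ e₂

open Exchange.Expr in
/-- The median of three keys. -/
def medianBody : Expr :=
  bind (fst (var 0)) <| bind (fst (snd (var 1))) <| bind (snd (snd (var 2))) <|
  ifKeyLe (var 2) (var 1)
    (ifKeyLe (var 1) (var 0) (var 1) (ifKeyLe (var 2) (var 0) (var 0) (var 2)))
    (ifKeyLe (var 2) (var 0) (var 2) (ifKeyLe (var 1) (var 0) (var 0) (var 1)))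

open Exchange.Expr in
/-- The medians of consecutive triples. -/
def mediansBody : Expr :=
  ifNil (var 0) nil <| ifNil (snd (var 0)) nil <| ifNil (snd (snd (var 0))) nil <|
  pair
    (pair (num 2) (call 1 (pair (snd (fst (var 0)))
      (pair (snd (fst (snd (var 0)))) (snd (fst (snd (snd (var 0)))))))))
    (call 2 (snd (snd (snd (var 0)))))

open Exchange.Expr in
/-- The items below a key. -/
def belowBody : Expr :=
  ifNil (snd (var 0)) nil <|
  bind (call 3 (pair (fst (var 0)) (snd (snd (var 0))))) <|
  ifKeyLe (fst (var 1)) (snd (fst (snd (var 1)))) (var 0) (pair (fst (snd (var 1))) (var 0))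

open Exchange.Expr in
/-- The items above a key. -/
def aboveBody : Expr :=
  ifNil (snd (var 0)) nil <|
  bind (call 4 (pair (fst (var 0)) (snd (snd (var 0))))) <|
  ifKeyLe (snd (fst (snd (var 1)))) (fst (var 1)) (var 0) (pair (fst (snd (var 1))) (var 0))

open Exchange.Expr in
/-- The total weight of a list of items. -/
def weightBody : Expr :=
  ifNil (var 0) (num 0) (add (fst (fst (var 0))) (call 5 (snd (var 0))))

open Exchange.Expr in
/-- The length of a list. -/
def lengthBody : Expr := ifNil (var 0) (num 0) (add (num 1) (call 6 (snd (var 0))))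

open Exchange.Expr in
/-- Prepend the items of a list of orders on a given side to a list of items. -/
def itemsBody : Expr :=
  ifNil (fst (snd (var 0))) (snd (snd (var 0))) <|
  bind (fst (fst (snd (var 0)))) <|
  pair (pair (fst (snd (snd (var 0)))) (pair (fst (var 1)) (var 0)))
    (call 7 (pair (fst (var 1)) (pair (snd (fst (snd (var 1)))) (snd (snd (var 1))))))

open Exchange.Expr in
/-- Match a list of bids with a list of asks. -/
def pairUpBody : Expr :=
  bind (fst (snd (var 0))) <| bind (snd (snd (var 1))) <|
  ifNil (var 1) nil <| ifNil (var 0) nil <|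
  bind (fst (var 1)) <| bind (fst (var 1)) <|
  ifNatLe (fst (var 1)) (fst (var 0))
    (pair (pair (keyId (snd (var 1))) (pair (keyId (snd (var 0)))
        (pair (fst (var 1)) (fst (var 4)))))
      (call 8 (pair (fst (var 4)) (pair (snd (var 3))
        (pair (pair (sub (fst (var 0)) (fst (var 1))) (snd (var 0))) (snd (var 2)))))))
    (pair (pair (keyId (snd (var 1))) (pair (keyId (snd (var 0)))
        (pair (fst (var 0)) (fst (var 4)))))
      (call 8 (pair (fst (var 4)) (pair
        (pair (pair (sub (fst (var 1)) (fst (var 0))) (snd (var 1))) (snd (var 3)))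
        (snd (var 2))))))

open Exchange.Expr in
/-- Weighted selection: in a list of items, find a key such that the items below it have at most a
given total weight, and together with it at least that weight. -/
def selectBody : Expr :=
  bind (call 2 (call 2 (fst (var 0)))) <|
  bind (ifNil (var 0) (snd (fst (fst (var 1)))) (call 9 (pair (var 0) (call 6 (var 0))))) <|
  bind (call 3 (pair (var 0) (fst (var 2)))) <|
  bind (call 4 (pair (var 1) (fst (var 3)))) <|
  ifNatLe (call 5 (var 1)) (snd (var 4))
    (ifNatLe (snd (var 4)) (sub (call 5 (fst (var 4))) (call 5 (var 0))) (var 2)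
      (call 9 (pair (var 0) (sub (snd (var 4)) (sub (call 5 (fst (var 4))) (call 5 (var 0)))))))
    (call 9 (pair (var 1) (snd (var 4))))

open Exchange.Expr in
/-- The main expression of the program. -/
def mainBody : Expr :=
  bind (call 7 (pair (num 1) (pair (fst (var 0)) nil))) <|
  bind (call 7 (pair (num 0) (pair (snd (var 1)) nil))) <|
  bind (call 7 (pair (num 1) (pair (fst (var 2)) (var 0)))) <|
  ifNil (var 0) nil <|
  bind (call 5 (var 2)) <|
  bind (call 9 (pair (var 1) (var 0))) <|
  bind (sub (var 1) (call 5 (call 3 (pair (var 0) (var 2))))) <|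
  bind (call 3 (pair (var 1) (var 4))) <|
  bind (call 4 (pair (var 2) (var 6))) <|
  ifNatLe (keySide (var 3)) (num 0)
    (call 8 (pair (keyPrice (var 3)) (pair (var 0) (pair (pair (var 2) (var 3)) (var 1)))))
    (call 8 (pair (keyPrice (var 3))
      (pair (pair (pair (sub (keyQty (var 3)) (var 2)) (var 3)) (var 0)) (var 1))))

/-- The functions of the program. -/
def bodies : List Expr :=
  [leBody, medianBody, mediansBody, belowBody, aboveBody, weightBody, lengthBody, itemsBody,
    pairUpBody, selectBody]

/-! ### Correctness and running time of the auxiliary functions -/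

theorem runs_le (x y : Key) : Runs bodies [.pair (encodeKey x) (encodeKey y)] leBody
    (if rank x ≤ rank y then .nil else .pair .nil .nil) 60 := by
  -- The branch bounds `t` and `t'` are fixed here because the branches are proved only later; each
  -- is chosen large enough for its part of the decision tree.
  refine Runs.mono (.bind (.fst (.var rfl)) <| .bind (.snd (.var rfl)) <|
    .ifPriceLe (t := 40) (t' := 3)
      (runs_keyPrice (.var rfl)) (runs_keyPrice (.var rfl)) (fun h₁ => ?_) (fun h₁ => ?_)) ?_
  · refine Runs.mono (.ifPriceLe (t := 28) (t' := 3)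
      (runs_keyPrice (.var rfl)) (runs_keyPrice (.var rfl)) (fun h₂ => ?_) (fun h₂ => ?_)) ?_
    · refine Runs.mono (.ifNatLe (t := 23) (t' := 3)
        (runs_keySide (.var rfl)) (runs_keySide (.var rfl)) (fun h₃ => ?_) (fun h₃ => ?_)) ?_
      · refine Runs.mono (.ifNatLe (t := 18) (t' := 3)
          (runs_keySide (.var rfl)) (runs_keySide (.var rfl)) (fun h₄ => ?_) (fun h₄ => ?_)) ?_
        · refine Runs.mono (.ifNatLe (t := 14) (t' := 14)
            (runs_keySide (.var rfl)) .num (fun h₅ => ?_) (fun h₅ => ?_)) ?_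
          · refine Runs.mono (.ifNatLe (t := 3) (t' := 3)
              (runs_keyTime (.var rfl)) (runs_keyTime (.var rfl)) (fun h₆ => ?_) (fun h₆ => ?_)) ?_
            · rw [if_pos (by rw [rank_le_rank]; omega)]
              exact Runs.nil.mono (by omega)
            · rw [if_neg (by rw [rank_le_rank]; omega)]
              exact Runs.pair .nil .nil
            · norm_num
          · refine Runs.mono (.ifNatLe (t := 3) (t' := 3)
              (runs_keyTime (.var rfl)) (runs_keyTime (.var rfl)) (fun h₆ => ?_) (fun h₆ => ?_)) ?_
            · rw [if_pos (by rw [rank_le_rank]; omega)]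
              exact Runs.nil.mono (by omega)
            · rw [if_neg (by rw [rank_le_rank]; omega)]
              exact Runs.pair .nil .nil
            · norm_num
          · norm_num
        · rw [if_pos (by rw [rank_le_rank]; omega)]
          exact Runs.nil.mono (by omega)
        · norm_num
      · rw [if_neg (by rw [rank_le_rank]; omega)]
        exact Runs.pair .nil .nil
      · norm_num
    · rw [if_pos (by rw [rank_le_rank]; omega)]
      exact Runs.nil.mono (by omega)
    · norm_num
  · rw [if_neg (by rw [rank_le_rank]; omega)]
    exact Runs.pair .nil .nil
  · norm_num

/-- The 63 units are 60 for the comparison and one each for the pair, the call and the test. -/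
theorem runs_ifKeyLe {ρ : List Val} {e e' e₁ e₂ : Expr} {x y : Key} {w : Val} {s s' t t' : ℕ}
    (hx : Runs bodies ρ e (encodeKey x) s) (hy : Runs bodies ρ e' (encodeKey y) s')
    (h₁ : rank x ≤ rank y → Runs bodies ρ e₁ w t)
    (h₂ : rank y < rank x → Runs bodies ρ e₂ w t') :
    Runs bodies ρ (ifKeyLe e e' e₁ e₂) w (s + s' + max t t' + 63) := by
  have h := Runs.call (F := bodies) (f := 0) rfl (hx.pair hy) (runs_le x y)
  split_ifs at h with hxy
  · exact (h.ifNil_nil (h₁ hxy)).mono (by omega)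
  · exact (h.ifNil_pair (h₂ (not_le.1 hxy))).mono (by omega)

theorem runs_median (x y z : Key) :
    Runs bodies [.pair (encodeKey x) (.pair (encodeKey y) (encodeKey z))] medianBody
      (encodeKey (median x y z)) 300 := by
  refine Runs.mono (.bind (.fst (.var rfl)) <| .bind (.fst (.snd (.var rfl))) <|
    .bind (.snd (.snd (.var rfl))) <|
    runs_ifKeyLe (x := x) (y := y) (t := 140) (t' := 140) (.var rfl) (.var rfl)
      (fun h₁ => ?_) (fun h₁ => ?_)) ?_
  · refine Runs.mono (runs_ifKeyLe (x := y) (y := z) (t := 1) (.var rfl) (.var rfl) (fun h₂ => ?_)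
      (fun h₂ => runs_ifKeyLe (x := x) (y := z) (t := 1) (t' := 1)
      (.var rfl) (.var rfl) (fun h₃ => ?_)
      (fun h₃ => ?_))) ?_
    · rw [median, if_pos h₁, if_pos h₂]
      exact .var rfl
    · rw [median, if_pos h₁, if_neg h₂.not_ge, if_pos h₃]
      exact .var rfl
    · rw [median, if_pos h₁, if_neg h₂.not_ge, if_neg h₃.not_ge]
      exact .var rfl
    · norm_num
  · refine Runs.mono (runs_ifKeyLe (x := x) (y := z) (t := 1) (.var rfl) (.var rfl) (fun h₂ => ?_)
      (fun h₂ => runs_ifKeyLe (x := y) (y := z) (t := 1) (t' := 1)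
      (.var rfl) (.var rfl) (fun h₃ => ?_)
      (fun h₃ => ?_))) ?_
    · rw [median, if_neg h₁.not_ge, if_pos h₂]
      exact .var rfl
    · rw [median, if_neg h₁.not_ge, if_neg h₂.not_ge, if_pos h₃]
      exact .var rfl
    · rw [median, if_neg h₁.not_ge, if_neg h₂.not_ge, if_neg h₃.not_ge]
      exact .var rfl
    · norm_num
  · norm_num

theorem runs_medians (L : List Item) :
    Runs bodies [encodeItems L] mediansBody (encodeItems (medians L)) (400 * L.length + 20) := by
  induction L using medians.induct with
  | case1 x y z L ih =>
    refine Runs.mono (.ifNil_pair (.var rfl) <| .ifNil_pair (.snd (.var rfl)) <|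
      .ifNil_pair (.snd (.snd (.var rfl))) <| .pair (.pair .num <| .call rfl
        (.pair (.snd (.fst (.var rfl))) (.pair (.snd (.fst (.snd (.var rfl))))
          (.snd (.fst (.snd (.snd (.var rfl))))))) (runs_median x.2 y.2 z.2)) <|
      .call rfl (.snd (.snd (.snd (.var rfl)))) ih) ?_
    simp only [List.length_cons]
    omega
  | case2 L h =>
    match L, h with
    | [], _ => exact Runs.mono (.ifNil_nil (.var rfl) .nil) (by omega)
    | [x], _ =>
      exact Runs.mono (.ifNil_pair (.var rfl) <| .ifNil_nil (.snd (.var rfl)) .nil) (by omega)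
    | [x, y], _ =>
      exact Runs.mono (.ifNil_pair (.var rfl) <| .ifNil_pair (.snd (.var rfl)) <|
        .ifNil_nil (.snd (.snd (.var rfl))) .nil) (by omega)
    | x :: y :: z :: L, h => exact (h x y z L rfl).elim

/-- Only a non-strict test is available, so `y` is kept exactly when `rank x ≤ rank y.2` fails. -/
theorem runs_below (x : Key) (L : List Item) :
    Runs bodies [.pair (encodeKey x) (encodeItems L)] belowBody (encodeItems (below x L))
      (100 * L.length + 10) := by
  induction L with
  | nil => exact Runs.mono (.ifNil_nil (.snd (.var rfl)) .nil) (by omega)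
  | cons y L ih =>
    refine Runs.mono (.ifNil_pair (.snd (.var rfl)) <| .bind (.call rfl
      (.pair (.fst (.var rfl)) (.snd (.snd (.var rfl)))) ih) <|
      runs_ifKeyLe (x := x) (y := y.2) (t := 1) (t' := 5) (.fst (.var rfl))
        (.snd (.fst (.snd (.var rfl)))) (fun h => ?_) (fun h => ?_)) ?_
    · rw [show below x (y :: L) = below x L from List.filter_cons_of_neg (by simpa using h)]
      exact .var rfl
    · rw [show below x (y :: L) = y :: below x L from List.filter_cons_of_pos (by simpa using h)]
      exact .pair (.fst (.snd (.var rfl))) (.var rfl)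
    · simp only [List.length_cons]
      omega

theorem runs_above (x : Key) (L : List Item) :
    Runs bodies [.pair (encodeKey x) (encodeItems L)] aboveBody (encodeItems (above x L))
      (100 * L.length + 10) := by
  induction L with
  | nil => exact Runs.mono (.ifNil_nil (.snd (.var rfl)) .nil) (by omega)
  | cons y L ih =>
    refine Runs.mono (.ifNil_pair (.snd (.var rfl)) <| .bind (.call rfl
      (.pair (.fst (.var rfl)) (.snd (.snd (.var rfl)))) ih) <|
      runs_ifKeyLe (x := y.2) (y := x) (t := 1) (t' := 5)
        (.snd (.fst (.snd (.var rfl)))) (.fst (.var rfl)) (fun h => ?_) (fun h => ?_)) ?_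
    · rw [show above x (y :: L) = above x L from List.filter_cons_of_neg (by simpa using h)]
      exact .var rfl
    · rw [show above x (y :: L) = y :: above x L from List.filter_cons_of_pos (by simpa using h)]
      exact .pair (.fst (.snd (.var rfl))) (.var rfl)
    · simp only [List.length_cons]
      omega

theorem runs_weight (L : List Item) :
    Runs bodies [encodeItems L] weightBody (.nat (weight L)) (10 * L.length + 3) := by
  induction L with
  | nil => exact Runs.mono (.ifNil_nil (.var rfl) .num) (by omega)
  | cons y L ih =>
    refine Runs.mono (.ifNil_pair (.var rfl) <| .add (.fst (.fst (.var rfl))) <|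
      .call rfl (.snd (.var rfl)) ih) ?_
    simp only [List.length_cons]
    omega

theorem runs_length (L : List Item) :
    Runs bodies [encodeItems L] lengthBody (.nat L.length) (10 * L.length + 3) := by
  induction L with
  | nil => exact Runs.mono (.ifNil_nil (.var rfl) .num) (by omega)
  | cons y L ih =>
    rw [List.length_cons, add_comm L.length]
    exact Runs.mono (.ifNil_pair (.var rfl) <| .add .num <|
      .call rfl (.snd (.var rfl)) ih) (by omega)

theorem runs_items (s : ℕ) (L : List Order) (I : List Item) :
    Runs bodies [.pair (.nat s) (.pair (encodeList encodeOrder L) (encodeItems I))] itemsBody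
      (encodeItems (items s L ++ I)) (50 * L.length + 10) := by
  induction L with
  | nil => exact Runs.mono (.ifNil_nil (.fst (.snd (.var rfl))) (.snd (.snd (.var rfl)))) (by omega)
  | cons o L ih =>
    refine Runs.mono (.ifNil_pair (.fst (.snd (.var rfl))) <| .bind (.fst (.fst (.snd (.var rfl)))) <|
      .pair (.pair (.fst (.snd (.snd (.var rfl)))) (.pair (.fst (.var rfl)) (.var rfl))) <|
      .call rfl (.pair (.fst (.var rfl)) (.pair (.snd (.fst (.snd (.var rfl))))
        (.snd (.snd (.var rfl))))) ih) ?_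
    simp only [List.length_cons]
    omega

/-- Every round removes the head of one of the two lists for good, so the number of rounds is at
most the sum of the lengths. -/
theorem runs_pairUp (p : ℕ) (Bs As : List Item) :
    Runs bodies [.pair (.price p) (.pair (encodeItems Bs) (encodeItems As))] pairUpBody
      (encodeOutput (pairUp p Bs As)) (60 * (Bs.length + As.length) + 20) := by
  induction Bs, As using pairUp.induct with
  | case1 b Bs a As h ih =>
    rw [pairUp, if_pos h]
    refine Runs.mono (.bind (.fst (.snd (.var rfl))) <| .bind (.snd (.snd (.var rfl))) <|
      .ifNil_pair (.var rfl) <| .ifNil_pair (.var rfl) <| .bind (.fst (.var rfl)) <|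
      -- The second branch contradicts `h`, so its time bound is free and is set to 0.
      .bind (.fst (.var rfl)) <| .ifNatLe (m := b.1) (n := a.1) (t' := 0)
        (.fst (.var rfl)) (.fst (.var rfl)) (fun _ =>
        .pair (.pair (runs_keyId (k := b.2) (.snd (.var rfl)))
          (.pair (runs_keyId (k := a.2) (.snd (.var rfl)))
          (.pair (.fst (.var rfl)) (.fst (.var rfl))))) <|
        .call rfl (.pair (.fst (.var rfl)) (.pair (.snd (.var rfl)) (.pair (.pair
          (.sub (.fst (.var rfl)) (.fst (.var rfl))) (.snd (.var rfl))) (.snd (.var rfl))))) ih)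
        (fun h' => absurd h h'.not_ge)) ?_
    simp only [List.length_cons]
    omega
  | case2 b Bs a As h ih =>
    rw [pairUp, if_neg h]
    refine Runs.mono (.bind (.fst (.snd (.var rfl))) <| .bind (.snd (.snd (.var rfl))) <|
      .ifNil_pair (.var rfl) <| .ifNil_pair (.var rfl) <| .bind (.fst (.var rfl)) <|
      .bind (.fst (.var rfl)) <| .ifNatLe (m := b.1) (n := a.1) (t := 0)
        (.fst (.var rfl)) (.fst (.var rfl)) (fun h' => absurd h' h) (fun _ =>
        .pair (.pair (runs_keyId (k := b.2) (.snd (.var rfl)))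
          (.pair (runs_keyId (k := a.2) (.snd (.var rfl)))
          (.pair (.fst (.var rfl)) (.fst (.var rfl))))) <|
        .call rfl (.pair (.fst (.var rfl)) (.pair (.pair (.pair
          (.sub (.fst (.var rfl)) (.fst (.var rfl))) (.snd (.var rfl))) (.snd (.var rfl)))
          (.snd (.var rfl)))) ih)) ?_
    simp only [List.length_cons]
    omega
  | case3 As =>
    rw [pairUp]
    exact Runs.mono (.bind (.fst (.snd (.var rfl))) <| .bind (.snd (.snd (.var rfl))) <|
      .ifNil_nil (.var rfl) .nil) (by omega)
  | case4 b Bs =>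
    rw [pairUp]
    exact Runs.mono (.bind (.fst (.snd (.var rfl))) <| .bind (.snd (.snd (.var rfl))) <|
      .ifNil_pair (.var rfl) <| .ifNil_nil (.var rfl) .nil) (by omega)

/-! ### Weighted selection in linear time -/

theorem weight_nil : weight [] = 0 := rfl

theorem weight_cons (x : Item) (L : List Item) : weight (x :: L) = x.1 + weight L := by
  simp [weight]

theorem weight_append (L L' : List Item) : weight (L ++ L') = weight L + weight L' := by
  simp [weight]

/-- Inclusion–exclusion: the items satisfying both conditions are counted twice on the left. -/
theorem weight_filter_add_le (p q : Item → Bool) (L : List Item) :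
    weight (L.filter p) + weight (L.filter q) ≤ weight ((L.filter q).filter p) + weight L := by
  induction L with
  | nil => simp [weight]
  | cons x L ih =>
    cases hp : p x <;> cases hq : q x <;>
      simp only [List.filter_cons, hp, hq, weight_cons, if_true, if_false, Bool.false_eq_true] <;>
      omega

theorem weight_filter_le (p : Item → Bool) (L : List Item) : weight (L.filter p) ≤ weight L := by
  induction L with
  | nil => simp
  | cons x L ih =>
    cases hp : p x <;>
      simp only [List.filter_cons, hp, weight_cons, if_true, if_false, Bool.false_eq_true] <;> omega

theorem weight_eq_two_mul_length {L : List Item} (h : ∀ y ∈ L, y.1 = 2) :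
    weight L = 2 * L.length := by
  induction L with
  | nil => rfl
  | cons x L ih =>
    rw [weight_cons, ih fun y hy => h y (List.mem_cons_of_mem _ hy), h x List.mem_cons_self,
      List.length_cons]
    ring

/-! ### Medians of triples as a source of pivots -/

theorem length_medians (L : List Item) : (medians L).length = L.length / 3 := by
  induction L using medians.induct with
  | case1 x y z L ih =>
    simp only [medians, List.length_cons, ih]
    omega
  | case2 L h =>
    match L, h with
    | [], _ => rfl
    | [x], _ => simp [medians]
    | [x, y], _ => simp [medians]
    | x :: y :: z :: L, h => exact (h x y z L rfl).elim

theorem median_eq (x y z : Key) : median x y z = x ∨ median x y z = y ∨ median x y z = z := by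
  unfold median
  split_ifs <;> simp

theorem mem_medians {L : List Item} {m : Item} (hm : m ∈ medians L) :
    m.1 = 2 ∧ ∃ y ∈ L, y.2 = m.2 := by
  induction L using medians.induct with
  | case1 x y z L ih =>
    rw [medians, List.mem_cons] at hm
    rcases hm with rfl | hm
    · refine ⟨rfl, ?_⟩
      rcases median_eq x.2 y.2 z.2 with h | h | h
      · exact ⟨x, by simp, h.symm⟩
      · exact ⟨y, by simp, h.symm⟩
      · exact ⟨z, by simp, h.symm⟩
    · obtain ⟨h, y, hy, e⟩ := ih hm
      exact ⟨h, y, by simp [hy], e⟩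
  | case2 L h =>
    rw [medians] at hm
    · simp at hm
    · exact h

/-- The number of the items in `L` that are not after `c`. -/
def countLe (c : Key) (L : List Item) : ℕ := L.countP fun y => rank y.2 ≤ rank c

/-- The number of the items in `L` that are not before `c`. -/
def countGe (c : Key) (L : List Item) : ℕ := L.countP fun y => rank c ≤ rank y.2

theorem countLe_cons (c : Key) (x : Item) (L : List Item) :
    countLe c (x :: L) = countLe c L + if rank x.2 ≤ rank c then 1 else 0 := by
  simp [countLe, List.countP_cons]

theorem countGe_cons (c : Key) (x : Item) (L : List Item) :
    countGe c (x :: L) = countGe c L + if rank c ≤ rank x.2 then 1 else 0 := by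
  simp [countGe, List.countP_cons]

/-- If the median of a triple is not after `c`, then at least two of its three members are not after
`c`. Leftover items outside the triples only help. -/
theorem two_mul_countLe_medians_le (c : Key) (L : List Item) :
    2 * countLe c (medians L) ≤ countLe c L := by
  induction L using medians.induct with
  | case1 x y z L ih =>
    have h : rank (median x.2 y.2 z.2) ≤ rank c →
        rank x.2 ≤ rank c ∧ rank y.2 ≤ rank c ∨ rank x.2 ≤ rank c ∧ rank z.2 ≤ rank c ∨
          rank y.2 ≤ rank c ∧ rank z.2 ≤ rank c := by
      unfold median
      split_ifs <;> grind
    simp only [medians, countLe_cons]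
    split_ifs <;> first | omega | tauto
  | case2 L h =>
    rw [medians]
    · simp [countLe]
    · exact h

theorem two_mul_countGe_medians_le (c : Key) (L : List Item) :
    2 * countGe c (medians L) ≤ countGe c L := by
  induction L using medians.induct with
  | case1 x y z L ih =>
    have h : rank c ≤ rank (median x.2 y.2 z.2) →
        rank c ≤ rank x.2 ∧ rank c ≤ rank y.2 ∨ rank c ≤ rank x.2 ∧ rank c ≤ rank z.2 ∨
          rank c ≤ rank y.2 ∧ rank c ≤ rank z.2 := by
      unfold median
      split_ifs <;> grind
    simp only [medians, countGe_cons]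
    split_ifs <;> first | omega | tauto
  | case2 L h =>
    rw [medians]
    · simp [countGe]
    · exact h

theorem length_below_add_countGe (c : Key) (L : List Item) :
    (below c L).length + countGe c L = L.length := by
  rw [below, countGe, ← List.countP_eq_length_filter, List.length_eq_countP_add_countP
    (fun y : Item => decide (rank y.2 < rank c)) (l := L)]
  simp

theorem length_above_add_countLe (c : Key) (L : List Item) :
    (above c L).length + countLe c L = L.length := by
  rw [above, countLe, ← List.countP_eq_length_filter, List.length_eq_countP_add_countP
    (fun y : Item => decide (rank c < rank y.2)) (l := L)]
  simp

/-- The pivot itself is never kept, so the recursion shrinks even when the list is too short to have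
medians. -/
theorem countGe_pos {c : Key} {L : List Item} {y : Item} (hy : y ∈ L) (h : y.2 = c) :
    0 < countGe c L :=
  List.countP_pos_iff.2 ⟨y, hy, by simp [h]⟩

theorem countLe_pos {c : Key} {L : List Item} {y : Item} (hy : y ∈ L) (h : y.2 = c) :
    0 < countLe c L :=
  List.countP_pos_iff.2 ⟨y, hy, by simp [h]⟩

/-! ### Splits of a list and how they survive discarding items -/

/-- The lowest `k` units of the items in `L` comprise the items below `x`, none of the items
above `x`, and part of the items at `x`. -/
def IsSplit (x : Key) (k : ℕ) (L : List Item) : Prop :=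
  weight (below x L) ≤ k ∧ k + weight (above x L) ≤ weight L

/-- Everything before `x` is before `p`, so discarding the items not before `p` leaves the weight
before `x` unchanged; inclusion–exclusion controls the weight after `x`. -/
theorem IsSplit.of_below {x p : Key} {k : ℕ} {L : List Item} (hx : rank x < rank p)
    (h : IsSplit x k (below p L)) : IsSplit x k L := by
  have e : below x (below p L) = below x L := by
    rw [below, below, List.filter_filter]
    refine List.filter_congr fun y _ => ?_
    simp only [Bool.and_eq_left_iff_imp, decide_eq_true_eq]
    exact fun h => h.trans hx
  have h' : weight (above x L) + weight (below p L) ≤ weight (above x (below p L)) + weight L :=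
    weight_filter_add_le _ _ L
  refine ⟨e ▸ h.1, ?_⟩
  have := h.2
  omega

/-- The mirror image: the discarded items all lie before `x`, and their total weight is subtracted
from `k`. -/
theorem IsSplit.of_above {x p : Key} {k : ℕ} {L : List Item} (hx : rank p < rank x)
    (hk : weight L - weight (above p L) < k)
    (h : IsSplit x (k - (weight L - weight (above p L))) (above p L)) : IsSplit x k L := by
  have e : above x (above p L) = above x L := by
    rw [above, above, List.filter_filter]
    refine List.filter_congr fun y _ => ?_
    simp only [Bool.and_eq_left_iff_imp, decide_eq_true_eq]
    exact fun h => hx.trans h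
  have h' : weight (below x L) + weight (above p L) ≤ weight (below x (above p L)) + weight L :=
    weight_filter_add_le _ _ L
  have h'' : weight (above p L) ≤ weight L := weight_filter_le _ L
  obtain ⟨h₁, h₂⟩ := h
  rw [e] at h₂
  exact ⟨by omega, by omega⟩

/-- Weight 2 for each item makes half of the total weight equal to the length, so a median can be
requested without division: for `k = L.length` at least half of the items are not after `c`. -/
theorem countLe_le_of_isSplit {c : Key} {k : ℕ} {L : List Item} (hL : ∀ y ∈ L, y.1 = 2)
    (h : IsSplit c k L) : k ≤ 2 * countLe c L := by
  have h₁ := h.2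
  rw [weight_eq_two_mul_length hL,
    weight_eq_two_mul_length (L := above c L) fun y hy => hL y (List.mem_of_mem_filter hy)] at h₁
  have := length_above_add_countLe c L
  omega

theorem countGe_le_of_isSplit {c : Key} {k : ℕ} {L : List Item} (hL : ∀ y ∈ L, y.1 = 2)
    (h : IsSplit c k L) : 2 * L.length ≤ k + 2 * countGe c L := by
  have h₁ := h.1
  rw [weight_eq_two_mul_length (L := below c L) fun y hy => hL y (List.mem_of_mem_filter hy)] at h₁
  have := length_below_add_countGe c L
  omega

/-- With n items, the remainder after pruning has at most n - 2⌊n/9⌋ of them, while the pivot costs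
about 40000⌊n/9⌋. This leaves about 40000⌊n/9⌋ units for the linear passes, which is ample for n ≥
9. For n < 9 there is no pivot call, and dropping the pivot alone saves 40000 units. Ranks need not
be distinct. -/
theorem runs_select (L : List Item) (k : ℕ) (hL : L ≠ []) (hk : k ≤ weight L) :
    ∃ x ∈ L, IsSplit x.2 k L ∧
      Runs bodies [.pair (encodeItems L) (.nat k)] selectBody (encodeKey x.2)
        (40000 * L.length) := by
  induction hn : L.length using Nat.strong_induction_on generalizing L k with
  | _ n ih =>
  have hn0 : 0 < L.length := List.length_pos_iff.2 hL
  set L' := medians (medians L) with hL'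
  have hlen : L'.length = n / 9 := by
    rw [hL', length_medians, length_medians, hn, Nat.div_div_eq_div_mul]
  obtain ⟨p, hp, hle, hge, hrun⟩ : ∃ p ∈ L, 2 * L'.length ≤ countLe p.2 L ∧
      2 * L'.length ≤ countGe p.2 L ∧
      Runs bodies [encodeItems L', .pair (encodeItems L) (.nat k)]
        (.ifNil (.var 0) (.snd (.fst (.fst (.var 1))))
          (.call 9 (.pair (.var 0) (.call 6 (.var 0)))))
        (encodeKey p.2) (40010 * L'.length + 20) := by
    -- With fewer than nine items there are no medians of medians; the head of the list then serves
    -- as pivot.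
    by_cases h0 : L' = []
    · obtain ⟨p, L₁, rfl⟩ := List.exists_cons_of_ne_nil hL
      refine ⟨p, List.mem_cons_self, by simp [h0], by simp [h0], ?_⟩
      rw [h0]
      exact Runs.mono (.ifNil_nil (.var rfl) (.snd (.fst (.fst (.var rfl))))) (by omega)
    · have h2 : ∀ y ∈ L', y.1 = 2 := fun y hy => (mem_medians hy).1
      obtain ⟨q, hq, hs, hr⟩ := ih L'.length (by omega) L' L'.length h0
        (by rw [weight_eq_two_mul_length h2]; omega) rfl
      obtain ⟨-, q', hq', e'⟩ := mem_medians hq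
      obtain ⟨-, p, hp, e⟩ := mem_medians hq'
      have e₂ : p.2 = q.2 := e.trans e'
      have h₁ := two_mul_countLe_medians_le p.2 L
      have h₂ := two_mul_countLe_medians_le p.2 (medians L)
      have h₃ := two_mul_countGe_medians_le p.2 L
      have h₄ := two_mul_countGe_medians_le p.2 (medians L)
      rw [← e₂] at hs hr
      have h₅ := countLe_le_of_isSplit h2 hs
      have h₆ := countGe_le_of_isSplit h2 hs
      rw [← hL'] at h₂ h₄
      -- At least half of `L'` lies on either side of the pivot (weakly), and each of the two rounds
      -- of medians doubles the count: a factor 4 · 1/2 = 2.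
      refine ⟨p, hp, by omega, by omega, ?_⟩
      obtain ⟨y, L₁, hy⟩ := List.exists_cons_of_ne_nil h0
      refine Runs.mono (.ifNil_pair (v := encodeItem y) (v' := encodeItems L₁)
        (.var (by rw [hy]; rfl)) <|
        .call rfl (.pair (.var rfl) (.call rfl (.var rfl) (runs_length L'))) hr) ?_
      omega
  have hlo := length_below_add_countGe p.2 L
  have hhi := length_above_add_countLe p.2 L
  have hlo' := countGe_pos hp rfl
  have hhi' := countLe_pos hp rfl
  have hm : (medians L).length ≤ n := by rw [length_medians]; omega
  -- The prefix common to all three outcomes: finding the pivot and partitioning. `T` is the cost of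
  -- the remaining recursive call.
  have key : ∀ (x : Key) (T : ℕ),
      Runs bodies [encodeItems (above p.2 L), encodeItems (below p.2 L), encodeKey p.2,
          encodeItems L', .pair (encodeItems L) (.nat k)]
        (.ifNatLe (.call 5 (.var 1)) (.snd (.var 4))
          (.ifNatLe (.snd (.var 4)) (.sub (.call 5 (.fst (.var 4))) (.call 5 (.var 0))) (.var 2)
            (.call 9 (.pair (.var 0)
              (.sub (.snd (.var 4)) (.sub (.call 5 (.fst (.var 4))) (.call 5 (.var 0)))))))
          (.call 9 (.pair (.var 1) (.snd (.var 4))))) (encodeKey x) (T + 70 * n + 60) →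
      T + 40000 * L'.length + 1300 * n + 500 ≤ 40000 * n →
      Runs bodies [.pair (encodeItems L) (.nat k)] selectBody (encodeKey x) (40000 * n) := by
    intro x T h hT
    refine Runs.mono (.bind (.call rfl (.call rfl (.fst (.var rfl)) (runs_medians L))
      (runs_medians (medians L))) <| .bind hrun <|
      .bind (.call rfl (.pair (.var rfl) (.fst (.var rfl))) (runs_below p.2 L)) <|
      .bind (.call rfl (.pair (.var rfl) (.fst (.var rfl))) (runs_above p.2 L)) h) ?_
    omega
  rcases le_or_gt (weight (below p.2 L)) k with h₁ | h₁
  · rcases le_or_gt k (weight L - weight (above p.2 L)) with h₂ | h₂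
    · refine ⟨p, hp, ⟨h₁, ?_⟩, key p.2 0 ?_ (by omega)⟩
      · have : weight (above p.2 L) ≤ weight L := weight_filter_le _ L
        omega
      · refine Runs.mono (.ifNatLe (t' := 0) (.call rfl (.var rfl) (runs_weight _))
          (.snd (.var rfl)) (fun _ => .ifNatLe (t' := 0) (.snd (.var rfl))
            (.sub (.call rfl (.fst (.var rfl)) (runs_weight _))
              (.call rfl (.var rfl) (runs_weight _)))
            (fun _ => .var rfl) (fun h => absurd h₂ h.not_ge)) (fun h => absurd h₁ h.not_ge)) ?_
        omega
    -- An empty upper part would put `k` above the total weight, against `hk`.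
    · have hne : above p.2 L ≠ [] := by
        intro h
        rw [h, weight_nil] at h₂
        omega
      obtain ⟨x, hx, hs, hr⟩ := ih (above p.2 L).length (by omega) (above p.2 L)
        (k - (weight L - weight (above p.2 L))) hne (by omega) rfl
      have hx' := List.mem_filter.1 hx
      refine ⟨x, hx'.1, hs.of_above (by simpa using hx'.2) h₂,
        key x.2 (40000 * (above p.2 L).length) ?_ (by omega)⟩
      refine Runs.mono (.ifNatLe (t' := 0) (.call rfl (.var rfl) (runs_weight _))
        (.snd (.var rfl)) (fun _ => .ifNatLe (t := 0) (.snd (.var rfl))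
          (.sub (.call rfl (.fst (.var rfl)) (runs_weight _))
            (.call rfl (.var rfl) (runs_weight _)))
          (fun h => absurd h h₂.not_ge) (fun _ => .call rfl (.pair (.var rfl)
            (.sub (.snd (.var rfl)) (.sub (.call rfl (.fst (.var rfl)) (runs_weight _))
              (.call rfl (.var rfl) (runs_weight _))))) hr)) (fun h => absurd h₁ h.not_ge)) ?_
      omega
  · have hne : below p.2 L ≠ [] := by
      intro h
      rw [h, weight_nil] at h₁
      omega
    obtain ⟨x, hx, hs, hr⟩ := ih (below p.2 L).length (by omega) (below p.2 L) k hne h₁.le rfl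
    have hx' := List.mem_filter.1 hx
    refine ⟨x, hx'.1, hs.of_below (by simpa using hx'.2),
      key x.2 (40000 * (below p.2 L).length) ?_ (by omega)⟩
    refine Runs.mono (.ifNatLe (t := 0) (.call rfl (.var rfl) (runs_weight _))
      (.snd (.var rfl)) (fun h => absurd h h₁.not_ge)
      (fun _ => .call rfl (.pair (.var rfl) (.snd (.var rfl))) hr)) ?_
    omega

/-! ### Pairing bids with asks -/

theorem tradedQty_cons (w : Order) (m : Transaction) (M : List Transaction) :
    tradedQty w (m :: M) = (if m.bid = w ∨ m.ask = w then m.qty else 0) + tradedQty w M := by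
  unfold tradedQty
  by_cases h : m.bid = w ∨ m.ask = w <;> simp [h]

theorem tradedQty_eq_zero {w : Order} {M : List Transaction}
    (h : ∀ m ∈ M, m.bid ≠ w ∧ m.ask ≠ w) : tradedQty w M = 0 := by
  induction M with
  | nil => rfl
  | cons m M ih =>
    rw [tradedQty_cons, ih fun m hm => h m (List.mem_cons_of_mem _ hm), if_neg]
    have := h m List.mem_cons_self
    tauto

theorem volume_cons (m : Transaction) (M : List Transaction) :
    volume (m :: M) = m.qty + volume M := by
  simp [volume]

/-- The orders of a list of items. -/
def orders (L : List Item) : List Order := L.map fun y => y.2.2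

theorem mem_pairUp {p : ℕ} {Bs As : List Item} {m : Transaction} (hm : m ∈ pairUp p Bs As) :
    m.bid ∈ orders Bs ∧ m.ask ∈ orders As ∧ m.price = p := by
  induction Bs, As using pairUp.induct with
  | case1 b Bs a As h ih =>
    rw [pairUp, if_pos h, List.mem_cons] at hm
    rcases hm with rfl | hm
    · simp [orders]
    · have := ih hm
      simp only [orders, List.map_cons, List.mem_cons] at this ⊢
      tauto
  | case2 b Bs a As h ih =>
    rw [pairUp, if_neg h, List.mem_cons] at hm
    rcases hm with rfl | hm
    · simp [orders]
    · have := ih hm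
      simp only [orders, List.map_cons, List.mem_cons] at this ⊢
      tauto
  | case3 As => simp [pairUp] at hm
  | case4 b Bs => simp [pairUp] at hm

/-- Each transaction exhausts its bid or its ask, and the dropped order does not occur in any later
transaction. This also covers transactions of quantity 0. -/
theorem nodup_pairUp (p : ℕ) {Bs As : List Item} (hB : (orders Bs).Nodup)
    (hA : (orders As).Nodup) : (pairUp p Bs As).Nodup := by
  induction Bs, As using pairUp.induct with
  | case1 b Bs a As h ih =>
    rw [pairUp, if_pos h, List.nodup_cons]
    obtain ⟨hb, hB⟩ := List.nodup_cons.1 hB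
    exact ⟨fun hm => hb (mem_pairUp hm).1, ih hB hA⟩
  | case2 b Bs a As h ih =>
    rw [pairUp, if_neg h, List.nodup_cons]
    obtain ⟨ha, hA⟩ := List.nodup_cons.1 hA
    exact ⟨fun hm => ha (mem_pairUp hm).2.1, ih hB hA⟩
  | case3 As => simp [pairUp]
  | case4 b Bs => simp [pairUp]

/-- Equal total weights make the lists run out together: what remains when one of them is empty has
weight 0. -/
theorem volume_pairUp (p : ℕ) {Bs As : List Item} (h : weight Bs = weight As) :
    volume (pairUp p Bs As) = weight As := by
  induction Bs, As using pairUp.induct with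
  | case1 b Bs a As hab ih =>
    simp only [weight_cons] at h ih ⊢
    rw [pairUp, if_pos hab, volume_cons, ih (by omega)]
    dsimp only
    omega
  | case2 b Bs a As hab ih =>
    simp only [weight_cons] at h ih ⊢
    rw [pairUp, if_neg hab, volume_cons, ih (by omega)]
  | case3 As =>
    rw [pairUp, ← h]
    rfl
  | case4 b Bs =>
    rw [pairUp]
    rfl

theorem tradedQty_pairUp_eq_zero (p : ℕ) {Bs As : List Item} {w : Order} (hB : w ∉ orders Bs)
    (hA : w ∉ orders As) : tradedQty w (pairUp p Bs As) = 0 := by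
  refine tradedQty_eq_zero fun m hm => ⟨?_, ?_⟩
  · rintro rfl
    exact hB (mem_pairUp hm).1
  · rintro rfl
    exact hA (mem_pairUp hm).2.1

theorem fst_eq_zero_of_weight_eq_zero {L : List Item} (h : weight L = 0) {y : Item} (hy : y ∈ L) :
    y.1 = 0 :=
  List.sum_eq_zero_iff.1 h _ (List.mem_map_of_mem hy)

/-- By the balance of weights every item is used up. Disjointness of the two sides matters because
`tradedQty` counts an order in either role. -/
theorem tradedQty_pairUp (p : ℕ) {Bs As : List Item} (h : weight Bs = weight As)
    (hB : (orders Bs).Nodup) (hA : (orders As).Nodup) (hBA : ∀ w ∈ orders Bs, w ∉ orders As)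
    {y : Item} (hy : y ∈ Bs ∨ y ∈ As) : tradedQty y.2.2 (pairUp p Bs As) = y.1 := by
  induction Bs, As using pairUp.induct generalizing y with
  | case1 b Bs a As hab ih =>
    have mem : ∀ {z : Item} {L : List Item}, z ∈ L → z.2.2 ∈ orders L :=
      fun hz => List.mem_map_of_mem hz
    simp only [weight_cons] at h ih
    rw [pairUp, if_pos hab, tradedQty_cons]
    obtain ⟨hb, hB'⟩ := List.nodup_cons.1 hB
    replace hb : b.2.2 ∉ orders Bs := hb
    have ha : a.2.2 ∉ orders As := (List.nodup_cons.1 hA).1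
    have hba : b.2.2 ∉ orders (a :: As) := hBA _ List.mem_cons_self
    have hBA' : ∀ w ∈ orders Bs, w ∉ orders (a :: As) :=
      fun w hw => hBA w (List.mem_cons_of_mem _ hw)
    replace ih := @ih (by omega) hB' hA hBA'
    have hab' : b.2.2 ≠ a.2.2 := fun e => hba (e ▸ mem List.mem_cons_self)
    simp only [List.mem_cons] at hy
    rcases hy with (rfl | hy) | (rfl | hy)
    -- The head bid is dropped here and trades nothing afterwards.
    · have := tradedQty_pairUp_eq_zero p (As := (a.1 - y.1, a.2) :: As) hb hba
      rw [if_pos (.inl rfl), this, add_zero]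
    · have h₁ : b.2.2 ≠ y.2.2 := fun e => hb (e ▸ mem hy)
      have h₂ : a.2.2 ≠ y.2.2 := fun e => hBA' _ (mem hy) (e ▸ mem List.mem_cons_self)
      rw [if_neg (by tauto), ih (.inl hy), zero_add]
    -- The head ask survives with its remaining quantity, which by induction is traded later.
    · have := ih (y := (y.1 - b.1, y.2)) (.inr List.mem_cons_self)
      rw [if_pos (.inr rfl), this]
      dsimp only
      omega
    · have h₁ : b.2.2 ≠ y.2.2 := fun e => hba (e ▸ mem (List.mem_cons_of_mem _ hy))
      have h₂ : a.2.2 ≠ y.2.2 := fun e => ha (e ▸ mem hy)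
      rw [if_neg (by tauto), ih (.inr (List.mem_cons_of_mem _ hy)), zero_add]
  | case2 b Bs a As hab ih =>
    have mem : ∀ {z : Item} {L : List Item}, z ∈ L → z.2.2 ∈ orders L :=
      fun hz => List.mem_map_of_mem hz
    simp only [weight_cons] at h ih
    rw [pairUp, if_neg hab, tradedQty_cons]
    obtain ⟨ha, hA'⟩ := List.nodup_cons.1 hA
    replace ha : a.2.2 ∉ orders As := ha
    have hb : b.2.2 ∉ orders Bs := (List.nodup_cons.1 hB).1
    have hab' : a.2.2 ∉ orders (b :: Bs) := fun e => hBA _ e List.mem_cons_self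
    have hBA' : ∀ w ∈ orders (b :: Bs), w ∉ orders As :=
      fun w hw e => hBA w hw (List.mem_cons_of_mem _ e)
    replace ih := @ih (by omega) hB hA' hBA'
    simp only [List.mem_cons] at hy
    rcases hy with (rfl | hy) | (rfl | hy)
    · have := ih (y := (y.1 - a.1, y.2)) (.inl List.mem_cons_self)
      rw [if_pos (.inl rfl), this]
      dsimp only
      omega
    · have h₁ : b.2.2 ≠ y.2.2 := fun e => hb (e ▸ mem hy)
      have h₂ : a.2.2 ≠ y.2.2 := fun e => hab' (e ▸ mem (List.mem_cons_of_mem _ hy))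
      rw [if_neg (by tauto), ih (.inl (List.mem_cons_of_mem _ hy)), zero_add]
    · rw [if_pos (.inr rfl)]
      have := tradedQty_pairUp_eq_zero p (Bs := (b.1 - y.1, b.2) :: Bs) hab' ha
      rw [this, add_zero]
    · have h₁ : b.2.2 ≠ y.2.2 := fun e => hBA' b.2.2 List.mem_cons_self (e ▸ mem hy)
      have h₂ : a.2.2 ≠ y.2.2 := fun e => ha (e ▸ mem hy)
      rw [if_neg (by tauto), ih (.inr hy), zero_add]
  | case3 As =>
    rw [pairUp, fst_eq_zero_of_weight_eq_zero (h.symm.trans weight_nil) (by simpa using hy)]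
    rfl
  | case4 b Bs =>
    rw [pairUp, fst_eq_zero_of_weight_eq_zero h (by simpa using hy)]
    rfl

/-! ### The split of the order book -/

theorem volume_le_sum_tradedQty {L : List Item} {M : List Transaction}
    (h : ∀ m ∈ M, ∃ y ∈ L, m.bid = y.2.2 ∨ m.ask = y.2.2) :
    volume M ≤ (L.map fun y => tradedQty y.2.2 M).sum := by
  induction M with
  | nil => simp [volume]
  | cons m M ih =>
    simp only [tradedQty_cons, List.sum_map_add, volume_cons]
    refine add_le_add ?_ (ih fun m hm => h m (List.mem_cons_of_mem _ hm))
    obtain ⟨y, hy, e⟩ := h m List.mem_cons_self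
    have := List.le_sum_of_mem (List.mem_map_of_mem
      (f := fun y : Item => if m.bid = y.2.2 ∨ m.ask = y.2.2 then m.qty else 0) hy)
    rwa [if_pos e] at this

/-- Weak duality: if every transaction meets an order of `L`, the capacities of these orders bound
the volume, as a vertex cover bounds a matching. -/
theorem volume_le_weight {L : List Item} {M : List Transaction}
    (h : ∀ m ∈ M, ∃ y ∈ L, m.bid = y.2.2 ∨ m.ask = y.2.2)
    (hL : ∀ y ∈ L, tradedQty y.2.2 M ≤ y.1) : volume M ≤ weight L :=
  (volume_le_sum_tradedQty h).trans (List.sum_le_sum hL)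

theorem mem_items {s : ℕ} {L : List Order} {y : Item} :
    y ∈ items s L ↔ ∃ o ∈ L, (o.qty, s, o) = y := List.mem_map

/-- The items `Bs` of bids and `As` of asks are parts of the orders in `B` and `A` that are to be
traded with each other. They are cut off at the key `x` of the order book. -/
structure IsAllocation (B A : List Order) (x : Key) (Bs As : List Item) : Prop where
  bid_side : ∀ y ∈ Bs, y.2.1 = 1
  bid_mem : ∀ y ∈ Bs, y.2.2 ∈ B
  bid_qty : ∀ y ∈ Bs, y.1 ≤ y.2.2.qty
  bid_rank : ∀ y ∈ Bs, rank x ≤ rank y.2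
  bid_nodup : (orders Bs).Nodup
  bid_full : ∀ y ∈ above x (items 1 B), y ∈ Bs
  bid_weight : weight (above x (items 1 B)) ≤ weight Bs
  ask_side : ∀ y ∈ As, y.2.1 = 0
  ask_mem : ∀ y ∈ As, y.2.2 ∈ A
  ask_qty : ∀ y ∈ As, y.1 ≤ y.2.2.qty
  ask_rank : ∀ y ∈ As, rank y.2 ≤ rank x
  ask_nodup : (orders As).Nodup
  ask_full : ∀ y ∈ below x (items 0 A), y ∈ As
  ask_weight : weight (below x (items 0 A)) ≤ weight As
  weight_eq : weight Bs = weight As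

theorem price_le_price {x y : Key} (h : rank x ≤ rank y) : x.2.price ≤ y.2.price := by
  rw [rank_le_rank] at h
  omega

theorem mem_orders {L : List Item} {w : Order} : w ∈ orders L ↔ ∃ y ∈ L, y.2.2 = w :=
  List.mem_map

namespace IsAllocation

variable {B A : List Order} {x : Key} {Bs As : List Item}

theorem disjoint (h : IsAllocation B A x Bs As) (hBA : (B ++ A).Nodup) :
    ∀ w ∈ orders Bs, w ∉ orders As := by
  intro w hw hw'
  obtain ⟨y, hy, rfl⟩ := mem_orders.1 hw
  obtain ⟨z, hz, e⟩ := mem_orders.1 hw'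
  exact List.disjoint_of_nodup_append hBA (h.bid_mem y hy) (e ▸ h.ask_mem z hz)

theorem tradedQty_eq (h : IsAllocation B A x Bs As) (hBA : (B ++ A).Nodup) (p : ℕ) {y : Item}
    (hy : y ∈ Bs ∨ y ∈ As) : tradedQty y.2.2 (pairUp p Bs As) = y.1 :=
  tradedQty_pairUp p h.weight_eq h.bid_nodup h.ask_nodup (h.disjoint hBA) hy

theorem isMatching (h : IsAllocation B A x Bs As) (hBA : (B ++ A).Nodup) :
    IsMatching B A (pairUp x.2.price Bs As) := by
  have hb : ∀ m ∈ pairUp x.2.price Bs As, m.bid ∈ B ∧ x.2.price ≤ m.bid.price := by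
    intro m hm
    obtain ⟨y, hy, e⟩ := mem_orders.1 (mem_pairUp hm).1
    exact e ▸ ⟨h.bid_mem y hy, price_le_price (h.bid_rank y hy)⟩
  have ha : ∀ m ∈ pairUp x.2.price Bs As, m.ask ∈ A ∧ m.ask.price ≤ x.2.price := by
    intro m hm
    obtain ⟨y, hy, e⟩ := mem_orders.1 (mem_pairUp hm).2.1
    exact e ▸ ⟨h.ask_mem y hy, price_le_price (h.ask_rank y hy)⟩
  refine ⟨fun m hm => (hb m hm).1, fun m hm => (ha m hm).1,
    fun m hm => (ha m hm).2.trans (hb m hm).2, fun m hm => ?_, fun m hm => ?_, fun w _ => ?_⟩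
  · rw [(mem_pairUp hm).2.2]
    exact (ha m hm).2
  · rw [(mem_pairUp hm).2.2]
    exact (hb m hm).2
  · by_cases hB : w ∈ orders Bs
    · obtain ⟨y, hy, rfl⟩ := mem_orders.1 hB
      rw [h.tradedQty_eq hBA _ (.inl hy)]
      exact h.bid_qty y hy
    by_cases hA : w ∈ orders As
    · obtain ⟨y, hy, rfl⟩ := mem_orders.1 hA
      rw [h.tradedQty_eq hBA _ (.inr hy)]
      exact h.ask_qty y hy
    rw [tradedQty_pairUp_eq_zero _ hB hA]
    exact Nat.zero_le _

/-- A traded bid is at or after `x`, and a more competitive bid has strictly larger rank, so it is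
strictly after `x` and fully allocated. For asks the order is reversed. -/
theorem isFair (h : IsAllocation B A x Bs As) (hBA : (B ++ A).Nodup) (p : ℕ) :
    IsFair B A (pairUp p Bs As) := by
  constructor
  · intro b₁ h₁ b₂ h₂ hc hq
    have hb : b₂ ∈ orders Bs := by
      by_contra hb
      rw [tradedQty_pairUp_eq_zero p hb] at hq
      · omega
      · intro ha
        obtain ⟨y, hy, rfl⟩ := mem_orders.1 ha
        exact List.disjoint_of_nodup_append hBA h₂ (h.ask_mem y hy)
    obtain ⟨y, hy, rfl⟩ := mem_orders.1 hb
    have hlt : rank y.2 < rank (1, b₁) := by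
      have := h.bid_side y hy
      rw [← not_le, rank_le_rank]
      unfold BidMoreCompetitive at hc
      dsimp only
      omega
    exact h.tradedQty_eq hBA p (y := (b₁.qty, 1, b₁)) (.inl (h.bid_full _ (List.mem_filter.2
      ⟨mem_items.2 ⟨b₁, h₁, rfl⟩, decide_eq_true ((h.bid_rank y hy).trans_lt hlt)⟩)))
  · intro a₁ h₁ a₂ h₂ hc hq
    have ha : a₂ ∈ orders As := by
      by_contra ha
      rw [tradedQty_pairUp_eq_zero p _ ha] at hq
      · omega
      · intro hb
        obtain ⟨y, hy, rfl⟩ := mem_orders.1 hb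
        exact List.disjoint_of_nodup_append hBA (h.bid_mem y hy) h₂
    obtain ⟨y, hy, rfl⟩ := mem_orders.1 ha
    have hlt : rank (0, a₁) < rank y.2 := by
      have := h.ask_side y hy
      rw [← not_le, rank_le_rank]
      unfold AskMoreCompetitive at hc
      dsimp only
      omega
    exact h.tradedQty_eq hBA p (y := (a₁.qty, 0, a₁)) (.inr (h.ask_full _ (List.mem_filter.2
      ⟨mem_items.2 ⟨a₁, h₁, rfl⟩, decide_eq_true (hlt.trans_le (h.ask_rank y hy))⟩)))

theorem volume_le (h : IsAllocation B A x Bs As) (p : ℕ) {M : List Transaction}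
    (hM : IsMatching B A M) (hu : IsUniform M) : volume M ≤ volume (pairUp p Bs As) := by
  rw [volume_pairUp p h.weight_eq]
  obtain ⟨q, hq⟩ := hu
  -- This decides which side serves as the cover: the asks before `x` or the bids after `x`.
  by_cases hlow : ∀ a ∈ A, a.price ≤ q → rank (0, a) < rank x
  · refine (volume_le_weight (L := below x (items 0 A)) (fun m hm => ?_) fun y hy => ?_).trans
      h.ask_weight
    · refine ⟨(m.ask.qty, 0, m.ask), List.mem_filter.2 ⟨mem_items.2 ⟨_, hM.ask_mem m hm, rfl⟩,
        decide_eq_true (hlow _ (hM.ask_mem m hm) ?_)⟩, .inr rfl⟩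
      exact hq m hm ▸ hM.ask_price_le m hm
    · obtain ⟨o, ho, rfl⟩ := mem_items.1 (List.mem_filter.1 hy).1
      exact hM.qty_le o (List.mem_append_right _ ho)
  · push Not at hlow
    -- Every bid in `M` costs at least `q`, hence at least as much as `a`; asks precede bids at
    -- equal prices, so the bid comes after `a` and thus strictly after `x`.
    obtain ⟨a, -, haq, hax⟩ := hlow
    rw [← h.weight_eq]
    refine (volume_le_weight (L := above x (items 1 B)) (fun m hm => ?_) fun y hy => ?_).trans
      h.bid_weight
    · refine ⟨(m.bid.qty, 1, m.bid), List.mem_filter.2 ⟨mem_items.2 ⟨_, hM.bid_mem m hm, rfl⟩,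
        decide_eq_true (hax.trans_lt ?_)⟩, .inl rfl⟩
      have h₁ := hM.price_le_bid m hm
      rw [hq m hm] at h₁
      rw [← not_le, rank_le_rank]
      dsimp only
      omega
    · obtain ⟨o, ho, rfl⟩ := mem_items.1 (List.mem_filter.1 hy).1
      exact hM.qty_le o (List.mem_append_left _ ho)

end IsAllocation

/-! ### From a split of the whole book to an allocation -/

theorem eq_of_rank_eq {x y : Key} (h : rank x = rank y) :
    x.1 = y.1 ∧ x.2.timestamp = y.2.timestamp := by
  have h₁ := h.le
  have h₂ := h.ge
  rw [rank_le_rank] at h₁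
  rw [rank_le_rank] at h₂
  omega

theorem weight_below_add_weight_above {x : Key} {L : List Item} (h : ∀ y ∈ L, rank y.2 ≠ rank x) :
    weight (below x L) + weight (above x L) = weight L := by
  induction L with
  | nil => rfl
  | cons y L ih =>
    have ih := ih fun z hz => h z (List.mem_cons_of_mem _ hz)
    unfold below above at *
    rcases (h y List.mem_cons_self).lt_or_gt with hy | hy
    · rw [List.filter_cons_of_pos (by simpa using hy),
        List.filter_cons_of_neg (by simpa using hy.le), weight_cons, weight_cons]
      omega
    · rw [List.filter_cons_of_neg (by simpa using hy.le),
        List.filter_cons_of_pos (by simpa using hy), weight_cons, weight_cons]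
      omega

theorem weight_below_add_weight_above_of_mem {y : Item} {L : List Item}
    (h : (L.map fun z => rank z.2).Nodup) (hy : y ∈ L) :
    weight (below y.2 L) + weight (above y.2 L) + y.1 = weight L := by
  induction L with
  | nil => simp at hy
  | cons z L ih =>
    obtain ⟨hz, hL⟩ := List.nodup_cons.1 h
    rcases List.mem_cons.1 hy with rfl | hy
    · have := weight_below_add_weight_above (x := y.2) (L := L)
        fun w hw e => hz (List.mem_map.2 ⟨w, hw, e⟩)
      unfold below above at *
      rw [List.filter_cons_of_neg (by simp), List.filter_cons_of_neg (by simp), weight_cons]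
      omega
    · have hne : rank z.2 ≠ rank y.2 := fun e => hz (List.mem_map.2 ⟨y, hy, e.symm⟩)
      have ih := ih hL hy
      unfold below above at *
      rcases hne.lt_or_gt with hy | hy
      · rw [List.filter_cons_of_pos (by simpa using hy),
          List.filter_cons_of_neg (by simpa using hy.le), weight_cons, weight_cons]
        omega
      · rw [List.filter_cons_of_neg (by simpa using hy.le),
          List.filter_cons_of_pos (by simpa using hy), weight_cons, weight_cons]
        omega

theorem nodup_rank_items (s : ℕ) {L : List Order} (h : (L.map Order.timestamp).Nodup) :
    ((items s L).map fun z => rank z.2).Nodup := by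
  rw [items, List.map_map]
  rw [List.Nodup, List.pairwise_map] at h ⊢
  exact h.imp fun hne e => hne (eq_of_rank_eq e).2

theorem orders_items (s : ℕ) (L : List Order) : orders (items s L) = L := by
  simp [orders, items, Function.comp_def]

theorem nodup_orders_items (s : ℕ) {L : List Order} (h : L.Nodup) :
    (orders (items s L)).Nodup := by
  rwa [orders_items]

theorem below_append (x : Key) (L L' : List Item) : below x (L ++ L') = below x L ++ below x L' :=
  List.filter_append ..

theorem above_append (x : Key) (L L' : List Item) : above x (L ++ L') = above x L ++ above x L' :=
  List.filter_append ..

/-- The cut runs through the ask `a`, whose units below the cut are traded. Together with the asks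
before `a` they balance the bids after `a`, since every bid is strictly on one side of `a`. -/
theorem isAllocation_of_ask {B A : List Order} {a : Order} (hB : B.Nodup) (hA : A.Nodup)
    (hA' : (A.map Order.timestamp).Nodup) (ha : a ∈ A)
    (h : IsSplit (0, a) (weight (items 1 B)) (items 1 B ++ items 0 A)) :
    IsAllocation B A (0, a) (above (0, a) (items 1 B))
      ((weight (items 1 B) - weight (below (0, a) (items 1 B ++ items 0 A)), 0, a) ::
        below (0, a) (items 0 A)) := by
  have hs₁ : (above (0, a) (items 1 B)).Sublist (items 1 B) := List.filter_sublist
  have hs₂ : (below (0, a) (items 0 A)).Sublist (items 0 A) := List.filter_sublist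
  have h₁ : weight (below (0, a) (items 1 B)) + weight (above (0, a) (items 1 B)) =
      weight (items 1 B) := by
    refine weight_below_add_weight_above fun y hy e => ?_
    obtain ⟨o, -, rfl⟩ := mem_items.1 hy
    exact one_ne_zero (eq_of_rank_eq e).1
  have h₂ := weight_below_add_weight_above_of_mem (nodup_rank_items 0 hA')
    (mem_items.2 ⟨a, ha, rfl⟩)
  -- `h₃` makes the truncated subtraction exact, and `h₄` bounds its value by `a.qty`.
  obtain ⟨h₃, h₄⟩ := h
  simp only [below_append, above_append, weight_append] at h₂ h₃ h₄ ⊢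
  constructor
  · intro y hy
    obtain ⟨o, -, rfl⟩ := mem_items.1 (hs₁.subset hy)
    rfl
  · intro y hy
    obtain ⟨o, ho, rfl⟩ := mem_items.1 (hs₁.subset hy)
    exact ho
  · intro y hy
    obtain ⟨o, -, rfl⟩ := mem_items.1 (hs₁.subset hy)
    exact le_rfl
  · intro y hy
    exact (of_decide_eq_true (List.mem_filter.1 hy).2).le
  · exact List.Nodup.sublist (hs₁.map _) (nodup_orders_items 1 hB)
  · exact fun y hy => hy
  · exact le_rfl
  · intro y hy
    rcases List.mem_cons.1 hy with rfl | hy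
    · rfl
    obtain ⟨o, -, rfl⟩ := mem_items.1 (hs₂.subset hy)
    rfl
  · intro y hy
    rcases List.mem_cons.1 hy with rfl | hy
    · exact ha
    obtain ⟨o, ho, rfl⟩ := mem_items.1 (hs₂.subset hy)
    exact ho
  · intro y hy
    rcases List.mem_cons.1 hy with rfl | hy
    · dsimp only
      omega
    obtain ⟨o, -, rfl⟩ := mem_items.1 (hs₂.subset hy)
    exact le_rfl
  · intro y hy
    rcases List.mem_cons.1 hy with rfl | hy
    · exact le_rfl
    exact (of_decide_eq_true (List.mem_filter.1 hy).2).le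
  · refine List.nodup_cons.2 ⟨fun hy => ?_, List.Nodup.sublist (hs₂.map _)
      (nodup_orders_items 0 hA)⟩
    obtain ⟨y, hy, e⟩ := mem_orders.1 hy
    obtain ⟨hy, hlt⟩ := List.mem_filter.1 hy
    obtain ⟨o, -, rfl⟩ := mem_items.1 hy
    obtain rfl : o = a := e
    simp at hlt
  · exact fun y hy => List.mem_cons_of_mem _ hy
  · rw [weight_cons]
    omega
  · rw [weight_cons]
    omega

/-- The cut runs through the bid `b`. Its units below the cut are the untraded ones, so the quantity
allocated to it is the complement in `b.qty`. -/
theorem isAllocation_of_bid {B A : List Order} {b : Order} (hB : B.Nodup) (hA : A.Nodup)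
    (hB' : (B.map Order.timestamp).Nodup) (hb : b ∈ B)
    (h : IsSplit (1, b) (weight (items 1 B)) (items 1 B ++ items 0 A)) :
    IsAllocation B A (1, b)
      ((b.qty - (weight (items 1 B) - weight (below (1, b) (items 1 B ++ items 0 A))), 1, b) ::
        above (1, b) (items 1 B))
      (below (1, b) (items 0 A)) := by
  have hs₁ : (above (1, b) (items 1 B)).Sublist (items 1 B) := List.filter_sublist
  have hs₂ : (below (1, b) (items 0 A)).Sublist (items 0 A) := List.filter_sublist
  have h₁ : weight (below (1, b) (items 0 A)) + weight (above (1, b) (items 0 A)) =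
      weight (items 0 A) := by
    refine weight_below_add_weight_above fun y hy e => ?_
    obtain ⟨o, -, rfl⟩ := mem_items.1 hy
    exact zero_ne_one (eq_of_rank_eq e).1
  have h₂ := weight_below_add_weight_above_of_mem (nodup_rank_items 1 hB')
    (mem_items.2 ⟨b, hb, rfl⟩)
  -- Together with `h₂` these make both nested truncated subtractions exact.
  obtain ⟨h₃, h₄⟩ := h
  simp only [below_append, above_append, weight_append] at h₂ h₃ h₄ ⊢
  constructor
  · intro y hy
    rcases List.mem_cons.1 hy with rfl | hy
    · rfl
    obtain ⟨o, -, rfl⟩ := mem_items.1 (hs₁.subset hy)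
    rfl
  · intro y hy
    rcases List.mem_cons.1 hy with rfl | hy
    · exact hb
    obtain ⟨o, ho, rfl⟩ := mem_items.1 (hs₁.subset hy)
    exact ho
  · intro y hy
    rcases List.mem_cons.1 hy with rfl | hy
    · exact Nat.sub_le _ _
    obtain ⟨o, -, rfl⟩ := mem_items.1 (hs₁.subset hy)
    exact le_rfl
  · intro y hy
    rcases List.mem_cons.1 hy with rfl | hy
    · exact le_rfl
    exact (of_decide_eq_true (List.mem_filter.1 hy).2).le
  · refine List.nodup_cons.2 ⟨fun hy => ?_, List.Nodup.sublist (hs₁.map _)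
      (nodup_orders_items 1 hB)⟩
    obtain ⟨y, hy, e⟩ := mem_orders.1 hy
    obtain ⟨hy, hlt⟩ := List.mem_filter.1 hy
    obtain ⟨o, -, rfl⟩ := mem_items.1 hy
    obtain rfl : o = b := e
    simp at hlt
  · exact fun y hy => List.mem_cons_of_mem _ hy
  · rw [weight_cons]
    omega
  · intro y hy
    obtain ⟨o, -, rfl⟩ := mem_items.1 (hs₂.subset hy)
    rfl
  · intro y hy
    obtain ⟨o, ho, rfl⟩ := mem_items.1 (hs₂.subset hy)
    exact ho
  · intro y hy
    obtain ⟨o, -, rfl⟩ := mem_items.1 (hs₂.subset hy)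
    exact le_rfl
  · intro y hy
    exact (of_decide_eq_true (List.mem_filter.1 hy).2).le
  · exact List.Nodup.sublist (hs₂.map _) (nodup_orders_items 0 hA)
  · exact fun y hy => hy
  · exact le_rfl
  · rw [weight_cons]
    omega

/-! ### The algorithm -/

/-- The algorithm. -/
def program : Program := ⟨bodies, mainBody⟩

theorem length_items (s : ℕ) (L : List Order) : (items s L).length = L.length := List.length_map _

theorem exists_allocation (B A : List Order) (hid : ((B ++ A).map Order.id).Nodup)
    (htime : ((B ++ A).map Order.timestamp).Nodup) (hne : B ++ A ≠ []) :
    ∃ (x : Key) (Bs As : List Item), IsAllocation B A x Bs As ∧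
      Runs bodies [encodeInput B A] mainBody (encodeOutput (pairUp x.2.price Bs As))
        (50000 * (B.length + A.length) + 1000) := by
  have hBA : (B ++ A).Nodup := hid.of_map
  obtain ⟨hB, hA, -⟩ := List.nodup_append.1 hBA
  rw [List.map_append] at htime
  obtain ⟨hB', hA', -⟩ := List.nodup_append.1 htime
  set C := items 1 B ++ items 0 A with hC
  have hClen : C.length = B.length + A.length := by
    rw [hC, List.length_append, length_items, length_items]
  have hpos : 0 < B.length + A.length := by
    rw [← List.length_append]
    exact List.length_pos_iff.2 hne
  have hCne : C ≠ [] := List.length_pos_iff.1 (hClen ▸ hpos)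
  obtain ⟨y, C', hyC⟩ := List.exists_cons_of_ne_nil hCne
  -- Cutting at the total bid quantity is what balances the two sides.
  obtain ⟨⟨w, s, o⟩, hx, hs, hr⟩ := runs_select C (weight (items 1 B)) hCne
    (by rw [hC, weight_append]; omega)
  have hlow : (below (s, o) (items 0 A)).length ≤ A.length :=
    (List.length_filter_le _ _).trans (length_items 0 A).le
  have hhigh : (above (s, o) (items 1 B)).length ≤ B.length :=
    (List.length_filter_le _ _).trans (length_items 1 B).le
  have hbelow : (below (s, o) C).length ≤ C.length := List.length_filter_le _ _
  have hlenB := length_items 1 B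
  have hlenA := length_items 0 A
  have hrB := runs_items 1 B []
  have hrA := runs_items 0 A []
  rw [List.append_nil] at hrB hrA
  have key : ∀ (Bs As : List Item),
      Runs bodies [encodeItems (above (s, o) (items 1 B)), encodeItems (below (s, o) (items 0 A)),
          .nat (weight (items 1 B) - weight (below (s, o) C)), encodeKey (s, o),
          .nat (weight (items 1 B)), encodeItems C, encodeItems (items 0 A),
          encodeItems (items 1 B), encodeInput B A]
        (.ifNatLe (keySide (.var 3)) (.num 0)
          (.call 8 (.pair (keyPrice (.var 3))
            (.pair (.var 0) (.pair (.pair (.var 2) (.var 3)) (.var 1)))))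
          (.call 8 (.pair (keyPrice (.var 3))
            (.pair (.pair (.pair (.sub (keyQty (.var 3)) (.var 2)) (.var 3)) (.var 0)) (.var 1)))))
        (encodeOutput (pairUp o.price Bs As)) (60 * (B.length + A.length) + 150) →
      Runs bodies [encodeInput B A] mainBody (encodeOutput (pairUp o.price Bs As))
        (50000 * (B.length + A.length) + 1000) := by
    intro Bs As h
    refine Runs.mono (.bind (.call rfl (.pair .num (.pair (.fst (.var rfl)) .nil)) hrB) <|
      .bind (.call rfl (.pair .num (.pair (.snd (.var rfl)) .nil)) hrA) <|
      .bind (.call rfl (.pair .num (.pair (.fst (.var rfl)) (.var rfl)))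
        (runs_items 1 B (items 0 A))) <|
      .ifNil_pair (v := encodeItem y) (v' := encodeItems C') (.var (by rw [← hC, hyC]; rfl)) <|
      .bind (.call rfl (.var rfl) (runs_weight _)) <|
      .bind (.call rfl (.pair (.var rfl) (.var rfl)) hr) <|
      .bind (.sub (.var rfl) (.call rfl (.call rfl (.pair (.var rfl) (.var rfl))
        (runs_below (s, o) C)) (runs_weight _))) <|
      .bind (.call rfl (.pair (.var rfl) (.var rfl)) (runs_below (s, o) (items 0 A))) <|
      .bind (.call rfl (.pair (.var rfl) (.var rfl)) (runs_above (s, o) (items 1 B))) h) ?_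
    omega
  rcases List.mem_append.1 hx with hx | hx
  · obtain ⟨b, hb, e⟩ := mem_items.1 hx
    obtain ⟨rfl, rfl, rfl⟩ : b.qty = w ∧ 1 = s ∧ b = o := by simpa using e
    refine ⟨(1, b), _, _, isAllocation_of_bid hB hA hB' hb hs, key _ _ ?_⟩
    refine Runs.mono (.ifNatLe (t := 0) (runs_keySide (k := (1, b)) (.var rfl)) .num
      (fun h => absurd h (by norm_num)) (fun _ => .call rfl
        (.pair (runs_keyPrice (k := (1, b)) (.var rfl)) (.pair (.pair (.pair
          (.sub (runs_keyQty (k := (1, b)) (.var rfl)) (.var rfl)) (.var rfl)) (.var rfl))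
          (.var rfl)))
        (runs_pairUp b.price ((b.qty - (weight (items 1 B) - weight (below (1, b) C)), 1, b) ::
          above (1, b) (items 1 B)) (below (1, b) (items 0 A))))) ?_
    rw [List.length_cons]
    omega
  · obtain ⟨a, ha, e⟩ := mem_items.1 hx
    obtain ⟨rfl, rfl, rfl⟩ : a.qty = w ∧ 0 = s ∧ a = o := by simpa using e
    refine ⟨(0, a), _, _, isAllocation_of_ask hB hA hA' ha hs, key _ _ ?_⟩
    refine Runs.mono (.ifNatLe (t' := 0) (runs_keySide (k := (0, a)) (.var rfl)) .num
      (fun _ => .call rfl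
        (.pair (runs_keyPrice (k := (0, a)) (.var rfl)) (.pair (.var rfl)
          (.pair (.pair (.var rfl) (.var rfl)) (.var rfl))))
        (runs_pairUp a.price (above (0, a) (items 1 B))
          ((weight (items 1 B) - weight (below (0, a) C), 0, a) ::
            below (0, a) (items 0 A)))) (fun h => absurd h (by norm_num))) ?_
    rw [List.length_cons]
    omega

theorem runs_mainBody_nil :
    Runs bodies [encodeInput [] []] mainBody (encodeOutput []) 1000 := by
  refine Runs.mono (.bind (.call rfl (.pair .num (.pair (.fst (.var rfl)) .nil))
      (runs_items 1 [] [])) <|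
    .bind (.call rfl (.pair .num (.pair (.snd (.var rfl)) .nil)) (runs_items 0 [] [])) <|
    .bind (.call rfl (.pair .num (.pair (.fst (.var rfl)) (.var rfl))) (runs_items 1 [] [])) <|
    .ifNil_nil (.var rfl) .nil) ?_
  simp

theorem isBigO_linear (a b : ℕ) :
    (fun n : ℕ => ((a * n + b : ℕ) : ℝ)) =O[atTop] fun n : ℕ => (n : ℝ) := by
  refine IsBigO.of_bound (a + b : ℕ) ?_
  filter_upwards [eventually_ge_atTop 1] with n hn
  rw [Real.norm_natCast, Real.norm_natCast]
  norm_cast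
  nlinarith

end Exchange

theorem theorem5 :
    ∃ (P : Exchange.Program) (T : ℕ → ℕ),
      ((fun n : ℕ => (T n : ℝ)) =O[Filter.atTop] fun n : ℕ => (n : ℝ)) ∧
      ∀ B A : List Exchange.Order,
        ((B ++ A).map Exchange.Order.id).Nodup →
        ((B ++ A).map Exchange.Order.timestamp).Nodup →
        ∃ (M : List Exchange.Transaction) (t : ℕ),
          P.HaltsWith (Exchange.encodeInput B A) (Exchange.encodeOutput M) t ∧
          t ≤ T (B.length + A.length) ∧
          M.Nodup ∧
          Exchange.IsMatching B A M ∧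
          Exchange.IsUniform M ∧
          Exchange.IsFair B A M ∧
          ∀ M' : List Exchange.Transaction,
            Exchange.IsMatching B A M' → Exchange.IsUniform M' →
              Exchange.volume M' ≤ Exchange.volume M := by
  refine ⟨Exchange.program, fun n => 50000 * n + 1000, Exchange.isBigO_linear _ _, ?_⟩
  intro B A hid htime
  -- Selection needs a nonempty list, so the program and the proof treat the empty book apart.
  by_cases hne : B ++ A = []
  · obtain ⟨rfl, rfl⟩ := List.append_eq_nil_iff.1 hne
    obtain ⟨t, ht, h⟩ := Exchange.runs_mainBody_nil
    refine ⟨[], t, h, by simpa using ht, List.nodup_nil, ⟨?_, ?_, ?_, ?_, ?_, ?_⟩, ⟨0, ?_⟩,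
      ⟨?_, ?_⟩, fun M' hM' _ => ?_⟩
    any_goals simp [Exchange.FairOnBids, Exchange.FairOnAsks]
    rw [List.eq_nil_iff_forall_not_mem.2 fun m hm => List.not_mem_nil (hM'.bid_mem m hm)]
  · obtain ⟨x, Bs, As, hall, t, ht, h⟩ := Exchange.exists_allocation B A hid htime hne
    have hBA : (B ++ A).Nodup := hid.of_map
    exact ⟨_, t, h, ht, Exchange.nodup_pairUp _ hall.bid_nodup hall.ask_nodup,
      hall.isMatching hBA, ⟨_, fun m hm => (Exchange.mem_pairUp hm).2.2⟩, hall.isFair hBA _,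
      fun M' hM' hu => hall.volume_le _ hM' hu⟩
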